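/- \textbf{Kelvin--Noether circulation theorem for the current.} Let $\mathcal D_0,\mathcal D\subseteq\mathbb R^2$ be open, $a,b\in\mathbb R$, and let $\sigma,Fr,\rho_{ref}>0$ be constants. Let $\phi_t:\mathcal D_0\to\mathcal D$, $t\in(a,b)$, be a smooth family of diffeomorphisms, and let $\hat{\boldsymbol v}$ (vector), $\zeta,D,\rho,p$ (scalars) be smooth fields on $(a,b)\times\mathcal D$ with $\rho>0$, such that $\hat{\boldsymbol v}_t\circ\phi_t=\partial_t\phi_t$, and such that the area form $D_t\,d^2r$ and the scalar $\rho_t$ are push-forwards by $\phi_t$ of a time-independent form $D_0\,d^2r_0$ and function $\rho_0$ on $\mathcal D_0$. Put $\hat w=\partial_t\zeta+\hat{\boldsymbol v}\cdot\nabla\zeta$, and suppose that Hamilton's principle $$0=\delta\int_a^b\!\!\int_{\mathcal D}\Big(\tfrac12\big(|\hat{\boldsymbol v}|^2+\sigma^2\hat w^2\big)-\frac{\rho_{ref}}{\rho}\frac{\zeta^2}{2Fr^2}\Big)D\rho-p(D-1)\;d^2r\,dt$$ holds for all smooth variations compactly supported in $(a,b)\times\mathcal D$, where $\delta\zeta$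 and $\delta p$ are arbitrary and the remaining variations are the Euler--Poincar\'e variations generated by an arbitrary vector field $\boldsymbol\xi$: $\delta\hat{\boldsymbol v}=\partial_t\boldsymbol\xi+(\hat{\boldsymbol v}\cdot\nabla)\boldsymbol\xi-(\boldsymbol\xi\cdot\nabla)\hat{\boldsymbol v}$, $\delta D=-\mathrm{div}(D\boldsymbol\xi)$, $\delta\rho=-\boldsymbol\xi\cdot\nabla\rho$. Let $c_t=\phi_t\circ c_0$ be a material loop, with $c_0$ a $C^1$ closed curve in $\mathcal D_0$. Then for every $t\in(a,b)$ the following derivatives exist and are as stated. (i) With $\tilde p=p+\frac{\rho_{ref}\zeta^2}{2Fr^2}$ and $\tilde\varpi=\tfrac12(|\hat{\boldsymbol v}|^2+\sigma^2\hat w^2)$, the full circulation satisfies $$\frac{d}{dt}\oint_{c_t}\big(\hat{\boldsymbol v}\cdot d\boldsymbol r+\sigma^2\hat w\,d\zeta\big)=-\oint_{c_t}\Big(\frac1\rho\,d\tilde p-d\tilde\varpi\Big).$$ (ii) The wave part satisfies $$\frac{d}{dt}\oint_{c_t}\sigma^2\hat w\,d\zeta=-\oint_{c_t}\Big(\frac1\rho\,d\frac{\rho_{ref}\zeta^2}{2Fr^2}-d\frac{\sigma^2\hat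 w^2}{2}\Big),$$ so that it cancels all the wave terms in (i). (iii) Hence the circulation of the current alone obeys the Euler result $$\frac{d}{dt}\oint_{c_t}\hat{\boldsymbol v}\cdot d\boldsymbol r=-\oint_{c_t}\Big(\frac1\rho\,dp-d\frac{|\hat{\boldsymbol v}|^2}{2}\Big),$$ in which the wave variables do not occur (non-acceleration). (iv) Circulation of the current is generated only through $\nabla\rho\times\nabla p$: if $\nabla\rho\times\nabla p=0$ at time $t$ on an open set $U\subseteq\mathcal D$ in which $c_t$ can be contracted to a point, then $\frac{d}{dt}\oint_{c_t}\hat{\boldsymbol v}\cdot d\boldsymbol r=0$ at time $t$. -/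

import Mathlib

open Set MeasureTheory
open scoped ContDiff

noncomputable section

namespace WaveCurrent

/-- The horizontal plane, with its Euclidean inner product. -/
abbrev Plane : Type := EuclideanSpace ℝ (Fin 2)

/-- Time derivative `∂_t f` at a fixed point `r`. -/
def timeDeriv {F : Type*} [NormedAddCommGroup F] [NormedSpace ℝ F]
    (f : ℝ → Plane → F) (t : ℝ) (r : Plane) : F :=
  deriv (fun τ => f τ r) t

/-- Divergence `∂₁ u₁ + ∂₂ u₂` of a planar vector field. -/
def divergence (u : Plane → Plane) (r : Plane) : ℝ :=
  ∑ i : Fin 2, fderiv ℝ u r (EuclideanSpace.single i 1) i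

/-- The scalar `∇f × ∇g = ∂₁ f ∂₂ g - ∂₂ f ∂₁ g`. -/
def gradCross (f g : Plane → ℝ) (r : Plane) : ℝ :=
  gradient f r 0 * gradient g r 1 - gradient f r 1 * gradient g r 0

/-- The space-time region `(a, b) × 𝒟`. -/
def spaceTime (a b : ℝ) (𝒟 : Set Plane) : Set (ℝ × Plane) := Ioo a b ×ˢ 𝒟

/-- The dynamical variables (as functions of time and horizontal position): horizontal current
velocity `v`, wave elevation `ζ`, areal density `D`, buoyancy (mass density) `ρ`, pressure `p`. -/
structure Fields where
  v : ℝ → Plane → Plane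
  ζ : ℝ → Plane → ℝ
  D : ℝ → Plane → ℝ
  ρ : ℝ → Plane → ℝ
  p : ℝ → Plane → ℝ

namespace Fields

/-- All the fields are smooth on `(a, b) × 𝒟`. -/
structure Smooth (S : Fields) (a b : ℝ) (𝒟 : Set Plane) : Prop where
  v : ContDiffOn ℝ ∞ (Function.uncurry S.v) (spaceTime a b 𝒟)
  ζ : ContDiffOn ℝ ∞ (Function.uncurry S.ζ) (spaceTime a b 𝒟)
  D : ContDiffOn ℝ ∞ (Function.uncurry S.D) (spaceTime a b 𝒟)
  ρ : ContDiffOn ℝ ∞ (Function.uncurry S.ρ) (spaceTime a b 𝒟)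
  p : ContDiffOn ℝ ∞ (Function.uncurry S.p) (spaceTime a b 𝒟)

/-- Vertical velocity `w = ∂_t ζ + v · ∇ζ`. -/
def w (S : Fields) (t : ℝ) (r : Plane) : ℝ :=
  timeDeriv S.ζ t r + fderiv ℝ (S.ζ t) r (S.v t r)

/-- The Lagrangian density
`(½ (|v|² + σ² (∂_t ζ + v · ∇ζ)²) - (ρ_ref / ρ) ζ² / (2 Fr²)) D ρ - p (D - 1)`. -/
def lagrangianDensity (σ Fr ρref : ℝ) (S : Fields) (t : ℝ) (r : Plane) : ℝ :=
  ((1 / 2) * (‖S.v t r‖ ^ 2 + σ ^ 2 * S.w t r ^ 2)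
      - (ρref / S.ρ t r) * (S.ζ t r ^ 2 / (2 * Fr ^ 2))) * (S.D t r * S.ρ t r)
    - S.p t r * (S.D t r - 1)

/-- The action over a space-time region `K`. -/
def action (σ Fr ρref : ℝ) (K : Set (ℝ × Plane)) (S : Fields) : ℝ :=
  ∫ x in K, lagrangianDensity σ Fr ρref S x.1 x.2

/-- The fields varied to amplitude `ε`. The variations `η` of `ζ` and `π` of `p` are free.
Those of `v`, `D` and `ρ` are the Euler-Poincaré variations that a displacement field `ξ` of the
horizontal flow map induces in the velocity, the advected density and the advected scalar:
`δv = ∂_t ξ + (v · ∇) ξ - (ξ · ∇) v`, `δD = - div (D ξ)`, `δρ = - ξ · ∇ρ`. -/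
def vary (S : Fields) (ξ : ℝ → Plane → Plane) (η π : ℝ → Plane → ℝ) (ε : ℝ) : Fields where
  v := fun t r => S.v t r +
    ε • (timeDeriv ξ t r + fderiv ℝ (ξ t) r (S.v t r) - fderiv ℝ (S.v t) r (ξ t r))
  ζ := fun t r => S.ζ t r + ε * η t r
  D := fun t r => S.D t r + ε * (- divergence (fun r' => S.D t r' • ξ t r') r)
  ρ := fun t r => S.ρ t r + ε * (- fderiv ℝ (S.ρ t) r (ξ t r))
  p := fun t r => S.p t r + ε * π t r

/-- Hamilton's principle `δS = 0`: the action is stationary under all smooth variations supported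
in a compact part `K` of `(a, b) × 𝒟`. (The variations vanish off `K`, so the contribution of the
complement of `K` to the action, which need not be finite, does not vary.) -/
def HamiltonPrinciple (σ Fr ρref a b : ℝ) (𝒟 : Set Plane) (S : Fields) : Prop :=
  ∀ K : Set (ℝ × Plane), IsCompact K → K ⊆ spaceTime a b 𝒟 →
  ∀ (ξ : ℝ → Plane → Plane) (η π : ℝ → Plane → ℝ),
    ContDiff ℝ ∞ (Function.uncurry ξ) → tsupport (Function.uncurry ξ) ⊆ K →
    ContDiff ℝ ∞ (Function.uncurry η) → tsupport (Function.uncurry η) ⊆ K →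
    ContDiff ℝ ∞ (Function.uncurry π) → tsupport (Function.uncurry π) ⊆ K →
    HasDerivAt (fun ε : ℝ => action σ Fr ρref K (S.vary ξ η π ε)) 0 0

end Fields

/-- `φ` is a smooth time-dependent family of diffeomorphisms `φ t : 𝒟₀ → 𝒟`, `t ∈ (a, b)`, from
the Lagrangian labels to the positions in the horizontal plane. -/
structure IsFlowMap (a b : ℝ) (𝒟₀ 𝒟 : Set Plane) (φ : ℝ → Plane → Plane) : Prop where
  smooth : ContDiffOn ℝ ∞ (Function.uncurry φ) (spaceTime a b 𝒟₀)
  bijOn : ∀ t ∈ Ioo a b, BijOn (φ t) 𝒟₀ 𝒟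
  det_ne_zero : ∀ t ∈ Ioo a b, ∀ r₀ ∈ 𝒟₀, (fderiv ℝ (φ t) r₀).det ≠ 0

/-- The kinematics: `v` is the Eulerian velocity of the flow, the area form `D d²r` is the
push-forward of a time-independent form `D₀ d²r₀` on the labels, and the scalar `ρ` is the
push-forward of a time-independent function `ρ₀` on the labels. -/
structure IsCarriedBy (a b : ℝ) (𝒟₀ : Set Plane) (φ : ℝ → Plane → Plane) (S : Fields) : Prop where
  velocity : ∀ t ∈ Ioo a b, ∀ r₀ ∈ 𝒟₀, timeDeriv φ t r₀ = S.v t (φ t r₀)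
  density : ∃ D₀ : Plane → ℝ, ∀ t ∈ Ioo a b, ∀ r₀ ∈ 𝒟₀,
    S.D t (φ t r₀) * (fderiv ℝ (φ t) r₀).det = D₀ r₀
  buoyancy : ∃ ρ₀ : Plane → ℝ, ∀ t ∈ Ioo a b, ∀ r₀ ∈ 𝒟₀, S.ρ t (φ t r₀) = ρ₀ r₀

/-- A smooth solution of the composition-of-maps wave-current model on `(a, b) × 𝒟`: smooth fields
with positive buoyancy, the current being the flow of `φ`, that satisfy Hamilton's principle. -/
structure IsSolution (σ Fr ρref a b : ℝ) (𝒟₀ 𝒟 : Set Plane) (φ : ℝ → Plane → Plane)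
    (S : Fields) : Prop where
  flow : IsFlowMap a b 𝒟₀ 𝒟 φ
  smooth : S.Smooth a b 𝒟
  carried : IsCarriedBy a b 𝒟₀ φ S
  buoyancy_pos : ∀ t ∈ Ioo a b, ∀ r ∈ 𝒟, 0 < S.ρ t r
  hamilton : S.HamiltonPrinciple σ Fr ρref a b 𝒟

/-- A closed material loop `c t = φ t ∘ c₀`, `t ∈ (a, b)`, carried by the flow, where `c₀` is a
continuously differentiable closed curve of labels. -/
structure MaterialLoop (a b : ℝ) (𝒟₀ : Set Plane) (φ : ℝ → Plane → Plane) where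
  base₀ : Plane
  c₀ : Path base₀ base₀
  contDiffOn_c₀ : ContDiffOn ℝ 1 c₀.extend (Icc 0 1)
  c₀_mem : ∀ s, c₀ s ∈ 𝒟₀
  base : ℝ → Plane
  c : (t : ℝ) → Path (base t) (base t)
  c_eq : ∀ t ∈ Ioo a b, ∀ s, c t s = φ t (c₀ s)

/-- The closed curve `γ` can be contracted to a point inside `U`. -/
def ContractibleIn (U : Set Plane) {x : Plane} (γ : Path x x) : Prop :=
  ∃ H : Path.Homotopy γ (Path.refl x), ∀ q, H q ∈ U

namespace Fields

/-- The current momentum one-form `v · dr`. -/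
def currentForm (S : Fields) (t : ℝ) (r : Plane) : Plane →L[ℝ] ℝ :=
  innerSL ℝ (S.v t r)

/-- The wave momentum one-form `σ² w dζ`. -/
def waveForm (σ : ℝ) (S : Fields) (t : ℝ) (r : Plane) : Plane →L[ℝ] ℝ :=
  (σ ^ 2 * S.w t r) • fderiv ℝ (S.ζ t) r

/-- The total pressure `p + ρ_ref ζ² / (2 Fr²)`. -/
def totalPressure (Fr ρref : ℝ) (S : Fields) (t : ℝ) (r : Plane) : ℝ :=
  S.p t r + ρref * S.ζ t r ^ 2 / (2 * Fr ^ 2)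

/-- The total kinetic energy per unit mass `½ (|v|² + σ² w²)`. -/
def totalKinetic (σ : ℝ) (S : Fields) (t : ℝ) (r : Plane) : ℝ :=
  (‖S.v t r‖ ^ 2 + σ ^ 2 * S.w t r ^ 2) / 2

end Fields

end WaveCurrent

end

open WaveCurrent

/-! Write `M = v · dr + σ² w dζ` and let `ℒ` be the Lie derivative along `v`. Pulling a circulation
back to the fixed loop of labels and using `∂_t (Dφ) = (∇v) Dφ` gives `d/dt ∮ α = ∮ (∂_t + ℒ) α`
round a material loop (`WaveCurrent.hasDerivAt_circulation`). Each circulation law therefore reduces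
to a pointwise formula for `(∂_t + ℒ) α`.

These formulas come from Hamilton's principle. The pressure variation gives `D = 1`, and then
Liouville's formula and the carried area form give `div v = 0`. The elevation variation gives `σ² ρ
(∂_t + v · ∇) w = -ρ_ref ζ / Fr²` (`vertical_motion`). Displacements `ξ = g e_i` give the law for
`M` (`horizontal_motion`, `totalForm_transport`). In each case the Lagrangian density is polynomial
in the amplitude, so the first variation is the integral of its linear coefficient, and a weak
conservation law becomes pointwise by integration by parts.

Non-acceleration rests on the kinematic identity `(∂_t + ℒ) dζ = dw`. Together with the vertical
equation it makes `(∂_t + ℒ)(σ² w dζ)` equal to exactly the wave terms in the law for `M`, and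
subtraction leaves Euler's law for `v · dr`.

Finally `d (ρ⁻¹ dp) = -ρ⁻² dρ ∧ dp`, so where `∇ρ × ∇p = 0` the integrand is closed and its integral
round a contractible loop vanishes (`curveIntegral_eq_zero_of_homotopy_refl`). -/

/-! ### Closed one-forms and null-homotopic loops. -/

section ClosedForms

open Filter Topology Function unitInterval

variable {E F : Type*} [NormedAddCommGroup E] [NormedSpace ℝ E]
  [NormedAddCommGroup F] [NormedSpace ℝ F]

/-- Around a convex quadrilateral the integrals of a closed one-form cancel. -/
theorem curveIntegral_segment_quadrilateral {α : E → E →L[ℝ] F} {s : Set E} (hs : Convex ℝ s)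
    (hso : IsOpen s) (hα : DifferentiableOn ℝ α s)
    (hsymm : ∀ x ∈ s, ∀ u v, fderiv ℝ α x u v = fderiv ℝ α x v u)
    {p q p' q' : E} (hp : p ∈ s) (hq : q ∈ s) (hp' : p' ∈ s) (hq' : q' ∈ s) :
    (∫ᶜ x in .segment p q, α x) + ∫ᶜ x in .segment q q', α x
      = (∫ᶜ x in .segment p p', α x) + ∫ᶜ x in .segment p' q', α x := by
  have hd : ∀ x ∈ s, HasFDerivWithinAt α (fderiv ℝ α x) s x := fun x hx =>
    (hα.differentiableAt (hso.mem_nhds hx)).hasFDerivAt.hasFDerivWithinAt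
  rw [hs.curveIntegral_segment_add_eq_of_hasFDerivWithinAt_symmetric hd
      (fun x hx u _ v _ => hsymm x hx u v) hp hq hq',
    hs.curveIntegral_segment_add_eq_of_hasFDerivWithinAt_symmetric hd
      (fun x hx u _ v _ => hsymm x hx u v) hp hp' hq']

/-- In a convex open set, the integral of a closed one-form along a `C¹` arc is its integral along
the chord. -/
theorem integral_arc_eq_curveIntegral_segment [CompleteSpace F] {α : E → E →L[ℝ] F} {s : Set E}
    (hs : Convex ℝ s) (hso : IsOpen s) (hα : DifferentiableOn ℝ α s)
    (hsymm : ∀ x ∈ s, ∀ u v, fderiv ℝ α x u v = fderiv ℝ α x v u)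
    {x y : E} {γ : Path x y} (hγ : ContDiffOn ℝ 1 γ.extend I) {c d : ℝ} (hc : 0 ≤ c) (hcd : c ≤ d)
    (hd : d ≤ 1) (hmem : ∀ θ ∈ Icc c d, γ.extend θ ∈ s) :
    ∫ θ in c..d, curveIntegralFun α γ θ = ∫ᶜ x in .segment (γ.extend c) (γ.extend d), α x := by
  have hdα : ∀ x ∈ s, HasFDerivWithinAt α (fderiv ℝ α x) s x := fun x hx =>
    (hα.differentiableAt (hso.mem_nhds hx)).hasFDerivAt.hasFDerivWithinAt
  have hsub : Icc c d ⊆ I := Icc_subset_Icc hc hd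
  have hcmem : γ.extend c ∈ s := hmem c ⟨le_rfl, hcd⟩
  have hprim : ∀ z ∈ s, HasFDerivAt (fun z => ∫ᶜ x in .segment (γ.extend c) z, α x) (α z) z :=
    fun z hz => (hs.hasFDerivWithinAt_curveIntegral_segment_of_hasFDerivWithinAt_symmetric hdα
      (fun x hx u _ v _ => hsymm x hx u v) hcmem hz).hasFDerivAt (hso.mem_nhds hz)
  have hcont : Continuous γ.extend := γ.continuous_extend
  -- On the convex set the integral over chords from `γ.extend c` is a primitive of `α`; the
  -- fundamental theorem is applied to it along the arc, and it vanishes at the starting point.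
  have key := intervalIntegral.integral_eq_sub_of_hasDerivAt_of_le
    (f := fun θ => ∫ᶜ x in .segment (γ.extend c) (γ.extend θ), α x)
    (f' := fun θ => curveIntegralFun α γ θ) hcd ?_ ?_ ?_
  · simpa using key
  · intro θ hθ
    exact ((hprim _ (hmem θ hθ)).continuousAt.comp
      (f := γ.extend) hcont.continuousAt).continuousWithinAt
  · intro θ hθ
    have hθI : I ∈ 𝓝 θ := Icc_mem_nhds (hc.trans_lt hθ.1) (hθ.2.trans_le hd)
    have h1 : HasDerivAt γ.extend (derivWithin γ.extend I θ) θ :=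
      (hγ.differentiableOn (by simp) θ
        (hsub (Ioo_subset_Icc_self hθ))).hasDerivWithinAt.hasDerivAt hθI
    rw [curveIntegralFun_def]
    exact (hprim _ (hmem θ (Ioo_subset_Icc_self hθ))).comp_hasDerivAt θ h1
  · refine ContinuousOn.intervalIntegrable_of_Icc hcd ?_
    simp only [funext (curveIntegralFun_def α γ)]
    refine ContinuousOn.clm_apply ?_ ?_
    · exact hα.continuousOn.comp hcont.continuousOn hmem
    · exact (hγ.continuousOn_derivWithin uniqueDiffOn_Icc_zero_one le_rfl).mono hsub

/-- The integral of a closed one-form along a null-homotopic `C¹` loop vanishes; the homotopy need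
only be continuous. -/
theorem curveIntegral_eq_zero_of_homotopy_refl [CompleteSpace F] {α : E → E →L[ℝ] F} {U : Set E}
    (hU : IsOpen U) (hα : DifferentiableOn ℝ α U)
    (hsymm : ∀ x ∈ U, ∀ u v, fderiv ℝ α x u v = fderiv ℝ α x v u)
    {x : E} {γ : Path x x} (hγ : ContDiffOn ℝ 1 γ.extend I)
    (H : Path.Homotopy γ (Path.refl x)) (hH : ∀ q, H q ∈ U) :
    ∫ᶜ z in γ, α z = 0 := by
  have hHc : Continuous H := H.continuous
  -- The compact image of the homotopy has a uniform margin `δ` inside `U`. With a mesh `1 / n`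
  -- below the modulus of continuity for `δ`, the four corners of each grid cell lie in one ball
  -- contained in `U`, where convexity is available.
  obtain ⟨δ, hδ, hδU⟩ : ∃ δ, 0 < δ ∧ Metric.thickening δ (range H) ⊆ U :=
    (isCompact_range hHc).exists_thickening_subset_open hU (range_subset_iff.2 hH)
  have hball : ∀ q, Metric.ball (H q) δ ⊆ U := fun q z hz =>
    hδU (Metric.mem_thickening_iff.2 ⟨H q, mem_range_self q, hz⟩)
  obtain ⟨η, hη, hηH⟩ := Metric.uniformContinuous_iff.1
    (CompactSpace.uniformContinuous_of_continuous hHc) δ hδ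
  obtain ⟨n, hn⟩ := exists_nat_gt (1 / η)
  have hn0 : (0 : ℝ) < n := (by positivity : (0 : ℝ) < 1 / η).trans hn
  have hstep : 1 / (n : ℝ) < η := by
    rw [div_lt_iff₀ hn0]; rw [div_lt_iff₀ hη] at hn; linarith
  -- Clamping the parameters to `[0, 1]` makes the estimates below hold for all real parameters, so
  -- no bound on the grid indices has to be carried.
  set G : ℝ → ℝ → E := fun s θ => H (projIcc 0 1 zero_le_one s, projIcc 0 1 zero_le_one θ) with hG
  have hproj : ∀ s s' : ℝ, dist (projIcc (0 : ℝ) 1 zero_le_one s) (projIcc 0 1 zero_le_one s')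
      ≤ dist s s' := fun s s' => by
    have := LipschitzWith.projIcc (zero_le_one (α := ℝ)) |>.dist_le_mul s s'
    simpa using this
  have hclose : ∀ s s' θ θ' : ℝ, dist s s' ≤ 1 / n → dist θ θ' ≤ 1 / n →
      G s' θ' ∈ Metric.ball (G s θ) δ := by
    intro s s' θ θ' h h'
    rw [Metric.mem_ball, dist_comm]
    refine hηH ?_
    rw [Prod.dist_eq, max_lt_iff]
    exact ⟨((hproj _ _).trans h).trans_lt hstep, ((hproj _ _).trans h').trans_lt hstep⟩
  have hgrid : ∀ k : ℕ, dist ((k : ℝ) / n) ((k + 1 : ℕ) / n) ≤ 1 / n := fun k => by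
    rw [Real.dist_eq, ← sub_div, abs_div, abs_of_pos hn0]; push_cast; simp
  have hself : ∀ s : ℝ, dist s s ≤ 1 / n := fun s => by rw [dist_self]; positivity
  -- `J j` is the integral along the polygon through the grid points of row `j`. Row `0` will give
  -- the loop and row `n` the constant path.
  set J : ℕ → F := fun j => ∑ k ∈ Finset.range n,
    ∫ᶜ z in .segment (G (j / n) (k / n)) (G (j / n) ((k + 1 : ℕ) / n)), α z with hJ
  have hG0 : ∀ s, G s 0 = x := fun s => by simp [hG]
  have hG1 : ∀ s, G s ((n : ℝ) / n) = x := fun s => by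
    rw [div_self hn0.ne']; simp [hG]
  have hJstep : ∀ j, J (j + 1) = J j := by
    intro j
    -- `V k` is the integral along the rung joining rows `j` and `j + 1`. The cell identities
    -- telescope to the two end rungs, which are degenerate because the homotopy fixes the base
    -- point.
    set V : ℕ → F := fun k =>
      ∫ᶜ z in .segment (G (j / n) (k / n)) (G ((j + 1 : ℕ) / n) (k / n)), α z with hV
    have hcell : ∀ k : ℕ, (∫ᶜ z in .segment (G ((j + 1 : ℕ) / n) (k / n))
          (G ((j + 1 : ℕ) / n) ((k + 1 : ℕ) / n)), α z)
        - ∫ᶜ z in .segment (G (j / n) (k / n)) (G (j / n) ((k + 1 : ℕ) / n)), α z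
        = V (k + 1) - V k := by
      intro k
      have hb := hball (projIcc 0 1 zero_le_one ((j : ℝ) / n),
        projIcc 0 1 zero_le_one ((k : ℝ) / n))
      have := curveIntegral_segment_quadrilateral (convex_ball (G (j / n) (k / n)) δ)
        Metric.isOpen_ball (hα.mono hb) (fun x hx => hsymm x (hb hx))
        (hclose _ _ _ _ (hself _) (hself _)) (hclose _ _ _ _ (hself _) (hgrid k))
        (hclose _ _ _ _ (hgrid j) (hself _)) (hclose _ _ _ _ (hgrid j) (hgrid k))
      rw [sub_eq_sub_iff_add_eq_add, hV, add_comm, ← this, add_comm]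
    have : J (j + 1) - J j = 0 := by
      rw [hJ, ← Finset.sum_sub_distrib, Finset.sum_congr rfl fun k _ => hcell k,
        Finset.sum_range_sub]
      have hVn : V n = 0 := by
        simp only [hV]
        rw [hG1, hG1, Path.segment_same, curveIntegral_refl]
      have hV0 : V 0 = 0 := by
        simp only [hV]
        rw [Nat.cast_zero, zero_div, hG0, hG0, Path.segment_same, curveIntegral_refl]
      rw [hVn, hV0, sub_zero]
    exact sub_eq_zero.1 this
  have hJconst : ∀ j, J j = J 0 := fun j => by
    induction j with
    | zero => rfl
    | succ j ih => rw [hJstep, ih]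
  have hJn : J n = 0 := by
    have : ∀ θ, G ((n : ℝ) / n) θ = x := fun θ => by
      rw [div_self hn0.ne']; simp [hG]
    refine Finset.sum_eq_zero fun k _ => ?_
    rw [this, this, Path.segment_same, curveIntegral_refl]
  have hG0γ : ∀ θ, G ((0 : ℕ) / n) θ = γ.extend θ := fun θ => by
    simp [hG, Path.extend, IccExtend]
  have hcI : CurveIntegrable α γ := hα.continuousOn.curveIntegrable_of_contDiffOn hγ fun θ => by
    have := hH (0, θ); simpa using this
  have hnode : ∀ k ≤ n, ((k : ℝ) / n) ∈ I := fun k hk =>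
    ⟨by positivity, by rw [div_le_one hn0]; exact_mod_cast hk⟩
  have hmono : ∀ k : ℕ, (k : ℝ) / n ≤ (k + 1 : ℕ) / n := fun k => by gcongr; simp
  -- Each arc of `γ` between consecutive nodes stays in the ball about its first node, so it may be
  -- replaced by its chord.
  have hJ0 : J 0 = ∫ᶜ z in γ, α z := by
    rw [curveIntegral_def]
    have := intervalIntegral.sum_integral_adjacent_intervals (μ := volume)
      (f := curveIntegralFun α γ) (a := fun k : ℕ => (k : ℝ) / n) (n := n) (fun k hk => ?_)
    · simp only [Nat.cast_zero, zero_div, div_self hn0.ne'] at this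
      rw [← this, hJ]
      refine Finset.sum_congr rfl fun k hk => ?_
      rw [Finset.mem_range] at hk
      have hb := hball (projIcc 0 1 zero_le_one (((0 : ℕ) : ℝ) / n),
        projIcc 0 1 zero_le_one ((k : ℝ) / n))
      rw [integral_arc_eq_curveIntegral_segment (convex_ball (G ((0 : ℕ) / n) (k / n)) δ)
        Metric.isOpen_ball (hα.mono hb) (fun x hx => hsymm x (hb hx)) hγ (hnode k hk.le).1
        (hmono k) (hnode (k + 1) hk).2, hG0γ, hG0γ]
      intro θ hθ
      rw [← hG0γ]
      refine hclose _ _ _ _ (hself _) ((Real.dist_le_of_mem_uIcc left_mem_uIcc ?_).trans (hgrid k))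
      rw [uIcc_of_le (hmono k)]; exact hθ
    · refine hcI.mono_set ?_
      rw [uIcc_of_le (hmono k), uIcc_of_le zero_le_one]
      exact Icc_subset_Icc (hnode k hk.le).1 (hnode (k + 1) hk).2
  rw [← hJ0, ← hJconst n, hJn]

end ClosedForms

/-! ### The fundamental lemma and first variations. -/

section CalculusOfVariations

open Filter Topology Function

variable {E : Type*} [NormedAddCommGroup E] [MeasurableSpace E] [BorelSpace E] {μ : Measure E}

theorem integrable_mul_of_tsupport_subset [IsFiniteMeasureOnCompacts μ] {Ω : Set E} {A g : E → ℝ}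
    (hA : ContinuousOn A Ω) (hg : Continuous g) {K : Set E} (hK : IsCompact K) (hKΩ : K ⊆ Ω)
    (hsupp : support g ⊆ K) : Integrable (fun x => A x * g x) μ := by
  have h1 : IntegrableOn (fun x => A x * g x) K μ :=
    ((hA.mono hKΩ).mul hg.continuousOn).integrableOn_compact hK
  refine (integrableOn_iff_integrable_of_support_subset ?_).1 h1
  exact (support_mul_subset_right _ _).trans hsupp

/-- A weak conservation law with continuous coefficients and `C¹` fluxes holds pointwise. -/
theorem eq_sum_fderiv_of_weak [NormedSpace ℝ E] [FiniteDimensional ℝ E] [μ.IsAddHaarMeasure]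
    {ι : Type*} [Fintype ι] {Ω : Set E}
    (hΩ : IsOpen Ω) {A : E → ℝ} {B : ι → E → ℝ} {e : ι → E} (hA : ContinuousOn A Ω)
    (hB : ∀ i, ContDiffOn ℝ 1 (B i) Ω)
    (h : ∀ g : E → ℝ, ContDiff ℝ ∞ g → HasCompactSupport g → tsupport g ⊆ Ω →
      ∫ x in tsupport g, (A x * g x + ∑ i, B i x * fderiv ℝ g x (e i)) ∂μ = 0) :
    ∀ x ∈ Ω, A x = ∑ i, fderiv ℝ (B i) x (e i) := by
  have hdB : ∀ i, ContinuousOn (fun x => fderiv ℝ (B i) x (e i)) Ω := fun i =>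
    ((hB i).continuousOn_fderiv_of_isOpen hΩ le_rfl).clm_apply continuousOn_const
  have hS : ContinuousOn (fun x => ∑ i, fderiv ℝ (B i) x (e i)) Ω :=
    continuousOn_finsetSum _ fun i _ => hdB i
  have hae : ∀ᵐ x ∂μ, x ∈ Ω → A x - ∑ i, fderiv ℝ (B i) x (e i) = 0 := by
    refine hΩ.ae_eq_zero_of_integral_contDiff_smul_eq_zero
      ((hA.sub hS).locallyIntegrableOn hΩ.measurableSet) fun g hg hgc hgΩ => ?_
    have hdg : ∀ i, Continuous fun x => fderiv ℝ g x (e i) := fun i =>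
      (hg.continuous_fderiv (by simp)).clm_apply continuous_const
    have hdgs : ∀ i, support (fun x => fderiv ℝ g x (e i)) ⊆ tsupport g := fun i x hx => by
      refine support_fderiv_subset ℝ (f := g) ?_
      intro h0; exact hx (by simp [h0])
    have iA : Integrable (fun x => A x * g x) μ :=
      integrable_mul_of_tsupport_subset hA hg.continuous hgc hgΩ (subset_tsupport g)
    have iB : ∀ i, Integrable (fun x => B i x * fderiv ℝ g x (e i)) μ := fun i =>
      integrable_mul_of_tsupport_subset (hB i).continuousOn (hdg i) hgc hgΩ (hdgs i)
    have iB' : ∀ i, Integrable (fun x => fderiv ℝ (B i) x (e i) * g x) μ := fun i =>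
      integrable_mul_of_tsupport_subset (hdB i) hg.continuous hgc hgΩ (subset_tsupport g)
    have iBg : ∀ i, Integrable (fun x => B i x * g x) μ := fun i =>
      integrable_mul_of_tsupport_subset (hB i).continuousOn hg.continuous hgc hgΩ
        (subset_tsupport g)
    -- There are no boundary terms, and the fluxes need to be differentiable only on the support of
    -- `g`, where they are known to be.
    have parts : ∀ i, ∫ x, B i x * fderiv ℝ g x (e i) ∂μ
        = - ∫ x, fderiv ℝ (B i) x (e i) * g x ∂μ := fun i =>
      integral_mul_fderiv_eq_neg_fderiv_mul_of_integrable (iB' i) (iB i) (iBg i)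
        (fun x hx => ((hB i).differentiableOn (by simp)).differentiableAt (hΩ.mem_nhds (hgΩ hx)))
        (fun x _ => hg.differentiable (by simp) x)
    have hw := h g hg hgc hgΩ
    rw [setIntegral_eq_integral_of_forall_compl_eq_zero, integral_add iA
      (integrable_finsetSum _ fun i _ => iB i), integral_finsetSum _ fun i _ => iB i,
      Finset.sum_congr rfl fun i _ => parts i, Finset.sum_neg_distrib] at hw
    · have : (fun x => g x • (A x - ∑ i, fderiv ℝ (B i) x (e i)))
          = fun x => A x * g x - ∑ i, fderiv ℝ (B i) x (e i) * g x := by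
        ext x; rw [smul_eq_mul, mul_sub, mul_comm, Finset.mul_sum]
        simp only [mul_comm]
      rw [this, integral_sub iA (integrable_finsetSum _ fun i _ => iB' i),
        integral_finsetSum _ fun i _ => iB' i]
      linarith
    · intro x hx
      have h0 : g x = 0 := image_eq_zero_of_notMem_tsupport hx
      have h1 : ∀ i, fderiv ℝ g x (e i) = 0 := fun i => by
        by_contra hne; exact hx (hdgs i hne)
      simp [h0, h1]
  refine Measure.eqOn_open_of_ae_eq (μ := μ) ?_ hΩ hA hS
  rw [EventuallyEq, ae_restrict_iff' hΩ.measurableSet]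
  filter_upwards [hae] with x hx hxΩ using sub_eq_zero.1 (hx hxΩ)

/-- The first variation of an integral whose integrand is polynomial in the amplitude. -/
theorem hasDerivAt_setIntegral_polynomial [IsFiniteMeasureOnCompacts μ] {K : Set E}
    (hK : IsCompact K) {n : ℕ} {c : Fin (n + 2) → E → ℝ} (hc : ∀ k, ContinuousOn (c k) K)
    {G : ℝ → E → ℝ} (hG : ∀ᶠ ε in 𝓝 (0 : ℝ), ∀ x ∈ K,
      G ε x = ∑ k : Fin (n + 2), ε ^ (k : ℕ) * c k x) :
    HasDerivAt (fun ε => ∫ x in K, G ε x ∂μ) (∫ x in K, c 1 x ∂μ) 0 := by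
  have hint : ∀ k, IntegrableOn (c k) K μ := fun k => (hc k).integrableOn_compact hK
  -- Integrating term by term makes the integral itself a polynomial in `ε` near `0`, so no
  -- differentiation under the integral sign is needed. The index type `Fin (n + 2)` guarantees a
  -- linear coefficient.
  have heq : (fun ε => ∫ x in K, G ε x ∂μ)
      =ᶠ[𝓝 0] fun ε => ∑ k : Fin (n + 2), ε ^ (k : ℕ) * ∫ x in K, c k x ∂μ := by
    filter_upwards [hG] with ε hε
    rw [setIntegral_congr_fun hK.measurableSet hε,
      integral_finsetSum _ fun k _ => (hint k).const_mul _]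
    simp only [integral_const_mul]
  refine HasDerivAt.congr_of_eventuallyEq ?_ heq
  have hsum : HasDerivAt (fun ε : ℝ => ∑ k : Fin (n + 2), ε ^ (k : ℕ) * ∫ x in K, c k x ∂μ)
      (∑ k : Fin (n + 2), ((k : ℕ) * (0 : ℝ) ^ ((k : ℕ) - 1)) * ∫ x in K, c k x ∂μ) 0 := by
    refine HasDerivAt.fun_sum fun k _ => ?_
    exact (hasDerivAt_pow (k : ℕ) (0 : ℝ)).mul_const _
  refine hsum.congr_deriv ?_
  -- Terms with `k > 1` vanish through the power of `0`. For `k = 0` the truncated exponent gives `0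
  -- ^ 0 = 1`, and it is the factor `k` that vanishes.
  rw [Finset.sum_eq_single 1]
  · simp
  · intro k _ hk
    rcases Nat.lt_or_ge 1 (k : ℕ) with h | h
    · rw [zero_pow (by omega)]; simp
    · have : (k : ℕ) = 0 := by
        rcases Nat.lt_or_ge (k : ℕ) 1 with h' | h'
        · omega
        · exact absurd (Fin.ext (by simp; omega)) hk
      simp [this]
  · simp

end CalculusOfVariations

namespace WaveCurrent

open Filter Topology Function

/-! ### Time, space and material derivatives of uncurried fields. -/

section Partial

variable {F : Type*} [NormedAddCommGroup F] [NormedSpace ℝ F]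

theorem isOpen_spaceTime {a b : ℝ} {𝒟 : Set Plane} (h𝒟 : IsOpen 𝒟) : IsOpen (spaceTime a b 𝒟) :=
  isOpen_Ioo.prod h𝒟

theorem mk_mem_spaceTime {a b t : ℝ} {𝒟 : Set Plane} {r : Plane} (ht : t ∈ Ioo a b) (hr : r ∈ 𝒟) :
    (t, r) ∈ spaceTime a b 𝒟 := ⟨ht, hr⟩

theorem hasFDerivAt_slice {f : ℝ → Plane → F} {t : ℝ} {r : Plane}
    (hf : DifferentiableAt ℝ (uncurry f) (t, r)) :
    HasFDerivAt (f t) ((fderiv ℝ (uncurry f) (t, r)).comp (ContinuousLinearMap.inr ℝ ℝ Plane)) r :=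
  hf.hasFDerivAt.comp r (hasFDerivAt_prodMk_right t r)

theorem fderiv_slice {f : ℝ → Plane → F} {t : ℝ} {r : Plane}
    (hf : DifferentiableAt ℝ (uncurry f) (t, r)) (u : Plane) :
    fderiv ℝ (f t) r u = fderiv ℝ (uncurry f) (t, r) (0, u) := by
  rw [(hasFDerivAt_slice hf).fderiv]; simp

theorem hasDerivAt_time {f : ℝ → Plane → F} {t : ℝ} {r : Plane}
    (hf : DifferentiableAt ℝ (uncurry f) (t, r)) :
    HasDerivAt (fun τ => f τ r) (fderiv ℝ (uncurry f) (t, r) (1, 0)) t :=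
  HasFDerivAt.comp_hasDerivAt t (f := fun τ : ℝ => (τ, r)) hf.hasFDerivAt
    ((hasDerivAt_id t).prodMk (hasDerivAt_const t r))

theorem timeDeriv_eq {f : ℝ → Plane → F} {t : ℝ} {r : Plane}
    (hf : DifferentiableAt ℝ (uncurry f) (t, r)) :
    timeDeriv f t r = fderiv ℝ (uncurry f) (t, r) (1, 0) :=
  (hasDerivAt_time hf).deriv

/-- The material derivative `(∂_t + u · ∇) f` splits into its time and space parts. -/
theorem fderiv_uncurry_one_mk {f : ℝ → Plane → F} {t : ℝ} {r : Plane}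
    (hf : DifferentiableAt ℝ (uncurry f) (t, r)) (u : Plane) :
    fderiv ℝ (uncurry f) (t, r) (1, u) = timeDeriv f t r + fderiv ℝ (f t) r u := by
  rw [timeDeriv_eq hf, fderiv_slice hf, ← map_add]; simp

/-- Along a particle path this is the material derivative, represented from here on by the
space-time differential applied to `(1, u)`. -/
theorem hasDerivAt_along {f : ℝ → Plane → F} {t : ℝ} {x : ℝ → Plane} {u : Plane}
    (hf : DifferentiableAt ℝ (uncurry f) (t, x t)) (hx : HasDerivAt x u t) :
    HasDerivAt (fun τ => f τ (x τ)) (fderiv ℝ (uncurry f) (t, x t) (1, u)) t :=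
  HasFDerivAt.comp_hasDerivAt t (f := fun τ : ℝ => (τ, x τ)) hf.hasFDerivAt
    ((hasDerivAt_id t).prodMk hx)

end Partial

/-! ### The deformation gradient and Liouville's formula. -/

section Flow

variable {a b : ℝ} {𝒟₀ 𝒟 : Set Plane} {φ V : ℝ → Plane → Plane}

theorem IsFlowMap.contDiffAt (hφ : IsFlowMap a b 𝒟₀ 𝒟 φ) (h𝒟₀ : IsOpen 𝒟₀) {t : ℝ}
    (ht : t ∈ Ioo a b) {r₀ : Plane} (hr₀ : r₀ ∈ 𝒟₀) : ContDiffAt ℝ ∞ (uncurry φ) (t, r₀) :=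
  hφ.smooth.contDiffAt ((isOpen_spaceTime h𝒟₀).mem_nhds ⟨ht, hr₀⟩)

theorem IsFlowMap.differentiableAt (hφ : IsFlowMap a b 𝒟₀ 𝒟 φ) (h𝒟₀ : IsOpen 𝒟₀) {t : ℝ}
    (ht : t ∈ Ioo a b) {r₀ : Plane} (hr₀ : r₀ ∈ 𝒟₀) : DifferentiableAt ℝ (uncurry φ) (t, r₀) :=
  (hφ.contDiffAt h𝒟₀ ht hr₀).differentiableAt (by simp)

theorem IsFlowMap.mem (hφ : IsFlowMap a b 𝒟₀ 𝒟 φ) {t : ℝ} (ht : t ∈ Ioo a b) {r₀ : Plane}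
    (hr₀ : r₀ ∈ 𝒟₀) : φ t r₀ ∈ 𝒟 := (hφ.bijOn t ht).mapsTo hr₀

theorem IsFlowMap.hasDerivAt (hφ : IsFlowMap a b 𝒟₀ 𝒟 φ) (h𝒟₀ : IsOpen 𝒟₀)
    (hV : ∀ t ∈ Ioo a b, ∀ r₀ ∈ 𝒟₀, timeDeriv φ t r₀ = V t (φ t r₀)) {t : ℝ} (ht : t ∈ Ioo a b)
    {r₀ : Plane} (hr₀ : r₀ ∈ 𝒟₀) : HasDerivAt (fun τ => φ τ r₀) (V t (φ t r₀)) t := by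
  have h := hasDerivAt_time (hφ.differentiableAt h𝒟₀ ht hr₀)
  rwa [← timeDeriv_eq (hφ.differentiableAt h𝒟₀ ht hr₀), hV t ht r₀ hr₀] at h

/-- The deformation gradient of a flow satisfies the linearised equation `∂_t (Dφ) = (∇V) Dφ`. -/
theorem IsFlowMap.hasDerivAt_fderiv (hφ : IsFlowMap a b 𝒟₀ 𝒟 φ) (h𝒟₀ : IsOpen 𝒟₀) (h𝒟 : IsOpen 𝒟)
    (hVs : ContDiffOn ℝ 1 (uncurry V) (spaceTime a b 𝒟))
    (hV : ∀ t ∈ Ioo a b, ∀ r₀ ∈ 𝒟₀, timeDeriv φ t r₀ = V t (φ t r₀)) {t : ℝ} (ht : t ∈ Ioo a b)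
    {r₀ : Plane} (hr₀ : r₀ ∈ 𝒟₀) (u : Plane) :
    HasDerivAt (fun τ => fderiv ℝ (φ τ) r₀ u)
      (fderiv ℝ (V t) (φ t r₀) (fderiv ℝ (φ t) r₀ u)) t := by
  have hc := hφ.contDiffAt h𝒟₀ ht hr₀
  have hd := hφ.differentiableAt h𝒟₀ ht hr₀
  have hΩ₀ : spaceTime a b 𝒟₀ ∈ 𝓝 (t, r₀) := (isOpen_spaceTime h𝒟₀).mem_nhds ⟨ht, hr₀⟩
  have hdd : DifferentiableAt ℝ (fderiv ℝ (uncurry φ)) (t, r₀) :=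
    (hc.fderiv_right (m := 1) (by norm_cast)).differentiableAt (by simp)
  -- Equality of mixed partials turns the time derivative of `Dφ u` into the derivative of the
  -- velocity `∂_t φ` along the label direction `u`.
  have hsymm : fderiv ℝ (fderiv ℝ (uncurry φ)) (t, r₀) (1, 0) (0, u)
      = fderiv ℝ (fderiv ℝ (uncurry φ)) (t, r₀) (0, u) (1, 0) :=
    (hc.isSymmSndFDerivAt (by simp; norm_cast)).eq _ _
  have hVd : DifferentiableAt ℝ (uncurry V) (t, φ t r₀) :=
    (hVs.differentiableOn (by simp)).differentiableAt
      ((isOpen_spaceTime h𝒟).mem_nhds ⟨ht, hφ.mem ht hr₀⟩)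
  -- The velocity equation holds on a whole neighbourhood in space-time, so both sides may be
  -- differentiated in the labels.
  have hvel : (fun x => fderiv ℝ (uncurry φ) x (1, 0))
      =ᶠ[𝓝 (t, r₀)] fun x => uncurry V (x.1, uncurry φ x) := by
    filter_upwards [hΩ₀] with x hx
    rw [← timeDeriv_eq (f := φ) (hφ.differentiableAt h𝒟₀ hx.1 hx.2), hV x.1 hx.1 x.2 hx.2]
    rfl
  have h1 : HasFDerivAt (fun x => fderiv ℝ (uncurry φ) x (1, 0))
      ((fderiv ℝ (fderiv ℝ (uncurry φ)) (t, r₀)).flip (1, 0)) (t, r₀) := by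
    simpa using hdd.hasFDerivAt.clm_apply (hasFDerivAt_const ((1, 0) : ℝ × Plane) (t, r₀))
  have h2 : HasFDerivAt (fun x => uncurry V (x.1, uncurry φ x))
      ((fderiv ℝ (uncurry V) (t, φ t r₀)).comp
        ((ContinuousLinearMap.fst ℝ ℝ Plane).prod (fderiv ℝ (uncurry φ) (t, r₀)))) (t, r₀) :=
    HasFDerivAt.comp (t, r₀) (f := fun x : ℝ × Plane => (x.1, uncurry φ x)) hVd.hasFDerivAt
      (hasFDerivAt_fst.prodMk hd.hasFDerivAt)
  have h3 := congrArg (fun A => A (0, u)) (h1.unique (h2.congr_of_eventuallyEq hvel))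
  simp only [ContinuousLinearMap.flip_apply, ContinuousLinearMap.comp_apply,
    ContinuousLinearMap.prod_apply, ContinuousLinearMap.coe_fst'] at h3
  have h4 : HasDerivAt (fun τ => fderiv ℝ (uncurry φ) (τ, r₀) (0, u))
      (fderiv ℝ (fderiv ℝ (uncurry φ)) (t, r₀) (1, 0) (0, u)) t := by
    have h5 : HasDerivAt (fun τ => fderiv ℝ (uncurry φ) (τ, r₀))
        (fderiv ℝ (fderiv ℝ (uncurry φ)) (t, r₀) (1, 0)) t :=
      HasFDerivAt.comp_hasDerivAt t (f := fun τ : ℝ => (τ, r₀)) hdd.hasFDerivAt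
        ((hasDerivAt_id t).prodMk (hasDerivAt_const t r₀))
    simpa using h5.clm_apply (hasDerivAt_const t ((0, u) : ℝ × Plane))
  rw [hsymm, h3, ← fderiv_slice hd, ← fderiv_slice hVd] at h4
  refine h4.congr_of_eventuallyEq ?_
  filter_upwards [isOpen_Ioo.mem_nhds ht] with τ hτ
  exact fderiv_slice (hφ.differentiableAt h𝒟₀ hτ hr₀) u

theorem det_eq_coordinates (A : Plane →L[ℝ] Plane) :
    A.det = A (EuclideanSpace.single 0 1) 0 * A (EuclideanSpace.single 1 1) 1
      - A (EuclideanSpace.single 1 1) 0 * A (EuclideanSpace.single 0 1) 1 := by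
  rw [ContinuousLinearMap.det, ← LinearMap.det_toMatrix (EuclideanSpace.basisFun (Fin 2) ℝ).toBasis,
    Matrix.det_fin_two]
  simp [LinearMap.toMatrix_apply]

theorem eq_single_add_single (u : Plane) :
    u = u 0 • EuclideanSpace.single 0 (1 : ℝ) + u 1 • EuclideanSpace.single 1 (1 : ℝ) := by
  ext i; fin_cases i <;> simp

/-- **Liouville's formula** `∂_t det Dφ = (div V) det Dφ`. -/
theorem IsFlowMap.hasDerivAt_det (hφ : IsFlowMap a b 𝒟₀ 𝒟 φ) (h𝒟₀ : IsOpen 𝒟₀) (h𝒟 : IsOpen 𝒟)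
    (hVs : ContDiffOn ℝ 1 (uncurry V) (spaceTime a b 𝒟))
    (hV : ∀ t ∈ Ioo a b, ∀ r₀ ∈ 𝒟₀, timeDeriv φ t r₀ = V t (φ t r₀)) {t : ℝ} (ht : t ∈ Ioo a b)
    {r₀ : Plane} (hr₀ : r₀ ∈ 𝒟₀) :
    HasDerivAt (fun τ => (fderiv ℝ (φ τ) r₀).det)
      (divergence (V t) (φ t r₀) * (fderiv ℝ (φ t) r₀).det) t := by
  have h : ∀ i j : Fin 2, HasDerivAt (fun τ => fderiv ℝ (φ τ) r₀ (EuclideanSpace.single j 1) i)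
      (fderiv ℝ (V t) (φ t r₀) (fderiv ℝ (φ t) r₀ (EuclideanSpace.single j 1)) i) t := fun i j =>
    (EuclideanSpace.proj i : Plane →L[ℝ] ℝ).hasFDerivAt.comp_hasDerivAt t
      (hφ.hasDerivAt_fderiv h𝒟₀ h𝒟 hVs hV ht hr₀ _)
  simp only [det_eq_coordinates]
  refine (((h 0 0).mul (h 1 1)).sub ((h 0 1).mul (h 1 0))).congr_deriv ?_
  -- What remains is the identity `MX × Y + X × MY = (tr M) (X × Y)` for the columns `X`, `Y` of
  -- `Dφ` and `M = ∇V`.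
  generalize fderiv ℝ (φ t) r₀ (EuclideanSpace.single 0 1) = X
  generalize fderiv ℝ (φ t) r₀ (EuclideanSpace.single 1 1) = Y
  rw [eq_single_add_single X, eq_single_add_single Y, divergence]
  generalize fderiv ℝ (V t) (φ t r₀) = M
  simp only [map_add, map_smul, Fin.sum_univ_two]
  simp
  ring

end Flow

/-! ### Rate of change of circulation round a material loop. -/

section Transport

open unitInterval

variable {a b : ℝ} {𝒟₀ 𝒟 : Set Plane} {φ V : ℝ → Plane → Plane}

theorem MaterialLoop.extend_mem (L : MaterialLoop a b 𝒟₀ φ) (s : ℝ) : L.c₀.extend s ∈ 𝒟₀ :=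
  L.c₀_mem _

theorem MaterialLoop.extend_eqOn (L : MaterialLoop a b 𝒟₀ φ) {t : ℝ} (ht : t ∈ Ioo a b) (s : ℝ) :
    (L.c t).extend s = φ t (L.c₀.extend s) :=
  L.c_eq t ht _

theorem MaterialLoop.contDiffOn_extend (L : MaterialLoop a b 𝒟₀ φ) (hφ : IsFlowMap a b 𝒟₀ 𝒟 φ)
    (h𝒟₀ : IsOpen 𝒟₀) {t : ℝ} (ht : t ∈ Ioo a b) : ContDiffOn ℝ 1 (L.c t).extend I := by
  have h : (L.c t).extend = φ t ∘ L.c₀.extend := funext (L.extend_eqOn ht)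
  rw [h]
  have hφt : ContDiffOn ℝ 1 (φ t) 𝒟₀ := fun r₀ hr₀ =>
    (((hφ.contDiffAt h𝒟₀ ht hr₀).of_le (by simp)).comp r₀
      (f := fun r : Plane => (t, r)) (by fun_prop)).contDiffWithinAt
  exact hφt.comp L.contDiffOn_c₀ fun s _ => L.extend_mem s

/-- The chain rule moves the integral to the fixed loop of labels, so that time enters through the
integrand only. -/
theorem MaterialLoop.curveIntegralFun_eq (L : MaterialLoop a b 𝒟₀ φ) (hφ : IsFlowMap a b 𝒟₀ 𝒟 φ)
    (h𝒟₀ : IsOpen 𝒟₀) {t : ℝ} (ht : t ∈ Ioo a b) (α : Plane → Plane →L[ℝ] ℝ) {s : ℝ} (hs : s ∈ I) :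
    curveIntegralFun α (L.c t) s = α (φ t (L.c₀.extend s))
      (fderiv ℝ (φ t) (L.c₀.extend s) (derivWithin L.c₀.extend I s)) := by
  have h : (L.c t).extend = φ t ∘ L.c₀.extend := funext (L.extend_eqOn ht)
  have hd : HasDerivWithinAt (φ t ∘ L.c₀.extend)
      (fderiv ℝ (φ t) (L.c₀.extend s) (derivWithin L.c₀.extend I s)) I s :=
    (hasFDerivAt_slice (hφ.differentiableAt h𝒟₀ ht
      (L.extend_mem s))).differentiableAt.hasFDerivAt.comp_hasDerivWithinAt s
      (L.contDiffOn_c₀.differentiableOn (by simp) s hs).hasDerivWithinAt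
  rw [curveIntegralFun_def, h, hd.derivWithin (uniqueDiffOn_Icc_zero_one s hs)]
  rfl

/-- Differentiation under the integral of a time-dependent form along a fixed curve. -/
theorem hasDerivAt_integral_form {A : ℝ × Plane → Plane →L[ℝ] ℝ} (h𝒟₀ : IsOpen 𝒟₀)
    (hA : ContDiffOn ℝ 1 A (spaceTime a b 𝒟₀)) {c c' : ℝ → Plane} (hc : ContinuousOn c I)
    (hc' : ContinuousOn c' I) (hmem : ∀ s ∈ I, c s ∈ 𝒟₀) {t : ℝ} (ht : t ∈ Ioo a b) :
    HasDerivAt (fun τ => ∫ s in (0 : ℝ)..1, A (τ, c s) (c' s))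
      (∫ s in (0 : ℝ)..1, fderiv ℝ A (t, c s) (1, 0) (c' s)) t := by
  have hΩ₀ := isOpen_spaceTime (a := a) (b := b) h𝒟₀
  have hd : ∀ τ ∈ Ioo a b, ∀ r₀ ∈ 𝒟₀,
      HasDerivAt (fun τ => A (τ, r₀)) (fderiv ℝ A (τ, r₀) (1, 0)) τ := fun τ hτ r₀ hr₀ =>
    HasFDerivAt.comp_hasDerivAt τ (f := fun τ : ℝ => (τ, r₀))
      ((hA.differentiableOn (by simp)).differentiableAt
        (hΩ₀.mem_nhds (mk_mem_spaceTime hτ hr₀))).hasFDerivAt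
      ((hasDerivAt_id τ).prodMk (hasDerivAt_const τ r₀))
  have hdc : ContinuousOn (fun x => fderiv ℝ A x (1, 0)) (spaceTime a b 𝒟₀) :=
    (hA.continuousOn_fderiv_of_isOpen hΩ₀ le_rfl).clm_apply continuousOn_const
  have hsc : ∀ τ : ℝ, ContinuousOn (fun s => ((τ, c s) : ℝ × Plane)) I := fun τ =>
    continuousOn_const.prodMk hc
  have hsm : ∀ τ ∈ Ioo a b, MapsTo (fun s => ((τ, c s) : ℝ × Plane)) I (spaceTime a b 𝒟₀) :=
    fun τ hτ s hs => ⟨hτ, hmem s hs⟩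
  -- A compact time interval round `t` times the compact curve bounds `∂_t A` uniformly, which
  -- supplies the constant dominating function `C * C'`.
  obtain ⟨δ, hδ, hδt⟩ := Metric.nhds_basis_closedBall.mem_iff.1 (isOpen_Ioo.mem_nhds ht)
  have hcompact : IsCompact (Metric.closedBall t δ ×ˢ (c '' I)) :=
    (isCompact_closedBall t δ).prod (isCompact_Icc.image_of_continuousOn hc)
  have hsubΩ : Metric.closedBall t δ ×ˢ (c '' I) ⊆ spaceTime a b 𝒟₀ := by
    rintro ⟨τ, r⟩ ⟨hτ, s, hs, rfl⟩
    exact ⟨hδt hτ, hmem s hs⟩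
  obtain ⟨C, hC⟩ := hcompact.exists_bound_of_continuousOn (hdc.mono hsubΩ)
  obtain ⟨C', hC'⟩ := isCompact_Icc.exists_bound_of_continuousOn hc'
  have hmeas : ∀ {G : ℝ → ℝ}, ContinuousOn G I →
      AEStronglyMeasurable G (volume.restrict (uIoc (0 : ℝ) 1)) := fun {G} hG => by
    rw [uIoc_of_le zero_le_one]
    exact (hG.mono Ioc_subset_Icc_self).aestronglyMeasurable measurableSet_Ioc
  have hGc : ∀ τ ∈ Ioo a b, ContinuousOn (fun s => A (τ, c s) (c' s)) I := fun τ hτ =>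
    (hA.continuousOn.comp (hsc τ) (hsm τ hτ)).clm_apply hc'
  refine (intervalIntegral.hasDerivAt_integral_of_dominated_loc_of_deriv_le (μ := volume)
    (a := 0) (b := 1) (F := fun τ s => A (τ, c s) (c' s))
    (F' := fun τ s => fderiv ℝ A (τ, c s) (1, 0) (c' s)) (x₀ := t) (bound := fun _ => C * C')
    (Metric.closedBall_mem_nhds t hδ) ?_ ?_ ?_ ?_ ?_ ?_).2
  · filter_upwards [isOpen_Ioo.mem_nhds ht] with τ hτ using hmeas (hGc τ hτ)
  · exact (hGc t ht).intervalIntegrable_of_Icc zero_le_one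
  · exact hmeas ((hdc.comp (hsc t) (hsm t ht)).clm_apply hc')
  · refine Eventually.of_forall fun s hs τ hτ => ?_
    rw [uIoc_of_le zero_le_one] at hs
    have hsI : s ∈ I := Ioc_subset_Icc_self hs
    have hCs := hC (τ, c s) ⟨hτ, mem_image_of_mem c hsI⟩
    exact ((fderiv ℝ A (τ, c s) (1, 0)).le_opNorm _).trans
      (mul_le_mul hCs (hC' s hsI) (norm_nonneg _) ((norm_nonneg _).trans hCs))
  · exact intervalIntegrable_const
  · refine Eventually.of_forall fun s hs τ hτ => ?_
    rw [uIoc_of_le zero_le_one] at hs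
    have := (hd τ (hδt hτ) _ (hmem s (Ioc_subset_Icc_self hs))).clm_apply
      (hasDerivAt_const τ (c' s))
    rwa [map_zero, add_zero] at this

/-- **Transport theorem for circulations**: the rate of change of the circulation of `α` round a
material loop is the circulation of `(∂_t + ℒ_V) α`. -/
theorem hasDerivAt_circulation (h𝒟₀ : IsOpen 𝒟₀) (h𝒟 : IsOpen 𝒟) (hφ : IsFlowMap a b 𝒟₀ 𝒟 φ)
    (hVs : ContDiffOn ℝ 1 (uncurry V) (spaceTime a b 𝒟))
    (hV : ∀ t ∈ Ioo a b, ∀ r₀ ∈ 𝒟₀, timeDeriv φ t r₀ = V t (φ t r₀))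
    (L : MaterialLoop a b 𝒟₀ φ) {α : ℝ → Plane → Plane →L[ℝ] ℝ}
    (hα : ContDiffOn ℝ 1 (uncurry α) (spaceTime a b 𝒟)) {t : ℝ} (ht : t ∈ Ioo a b)
    {β : Plane → Plane →L[ℝ] ℝ}
    (hβ : ∀ r ∈ 𝒟, ∀ u, β r u
      = fderiv ℝ (uncurry α) (t, r) (1, V t r) u + α t r (fderiv ℝ (V t) r u)) :
    HasDerivAt (fun τ => ∫ᶜ r in L.c τ, α τ r) (∫ᶜ r in L.c t, β r) t := by
  have hΩ₀ := isOpen_spaceTime (a := a) (b := b) h𝒟₀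
  -- the pull-back of the form to the labels
  obtain ⟨A, hA⟩ : ∃ A : ℝ × Plane → Plane →L[ℝ] ℝ, A = fun x =>
    (uncurry α (x.1, uncurry φ x)).comp
      ((fderiv ℝ (uncurry φ) x).comp (ContinuousLinearMap.inr ℝ ℝ Plane)) := ⟨_, rfl⟩
  have hAs : ContDiffOn ℝ 1 A (spaceTime a b 𝒟₀) := by
    rw [hA]
    refine ContDiffOn.clm_comp ?_ (ContDiffOn.clm_comp ?_ contDiffOn_const)
    · exact hα.comp (contDiffOn_fst.prodMk (hφ.smooth.of_le (by simp)))
        fun x hx => ⟨hx.1, hφ.mem hx.1 hx.2⟩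
    · exact hφ.smooth.fderiv_of_isOpen hΩ₀ (by norm_cast)
  have hAapply : ∀ τ ∈ Ioo a b, ∀ r₀ ∈ 𝒟₀, ∀ u,
      A (τ, r₀) u = α τ (φ τ r₀) (fderiv ℝ (φ τ) r₀ u) := fun τ hτ r₀ hr₀ u => by
    rw [fderiv_slice (hφ.differentiableAt h𝒟₀ hτ hr₀), hA]; rfl
  have hAd : ∀ r₀ ∈ 𝒟₀, HasDerivAt (fun τ => A (τ, r₀)) (fderiv ℝ A (t, r₀) (1, 0)) t :=
    fun r₀ hr₀ => HasFDerivAt.comp_hasDerivAt t (f := fun τ : ℝ => (τ, r₀))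
      ((hAs.differentiableOn (by simp)).differentiableAt
        (hΩ₀.mem_nhds (mk_mem_spaceTime ht hr₀))).hasFDerivAt
      ((hasDerivAt_id t).prodMk (hasDerivAt_const t r₀))
  -- The product rule along a particle path yields the two terms of the Lie derivative: one from the
  -- change of `α`, the other from the stretching `∂_t (Dφ) = (∇V) Dφ`.
  have hpoint : ∀ r₀ ∈ 𝒟₀, ∀ u, fderiv ℝ A (t, r₀) (1, 0) u
      = β (φ t r₀) (fderiv ℝ (φ t) r₀ u) := by
    intro r₀ hr₀ u
    have hαd : DifferentiableAt ℝ (uncurry α) (t, φ t r₀) :=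
      (hα.differentiableOn (by simp)).differentiableAt
        ((isOpen_spaceTime h𝒟).mem_nhds ⟨ht, hφ.mem ht hr₀⟩)
    have h1 : HasDerivAt (fun τ => α τ (φ τ r₀) (fderiv ℝ (φ τ) r₀ u))
        (fderiv ℝ (uncurry α) (t, φ t r₀) (1, V t (φ t r₀)) (fderiv ℝ (φ t) r₀ u)
          + α t (φ t r₀) (fderiv ℝ (V t) (φ t r₀) (fderiv ℝ (φ t) r₀ u))) t :=
      HasDerivAt.clm_apply (c := fun τ => α τ (φ τ r₀)) (u := fun τ => fderiv ℝ (φ τ) r₀ u)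
        (hasDerivAt_along (f := α) (x := fun τ => φ τ r₀) hαd (hφ.hasDerivAt h𝒟₀ hV ht hr₀))
        (hφ.hasDerivAt_fderiv h𝒟₀ h𝒟 hVs hV ht hr₀ u)
    have h2 := (hAd r₀ hr₀).clm_apply (hasDerivAt_const t u)
    rw [map_zero, add_zero] at h2
    rw [hβ _ (hφ.mem ht hr₀)]
    refine h2.unique (h1.congr_of_eventuallyEq ?_)
    filter_upwards [isOpen_Ioo.mem_nhds ht] with τ hτ using hAapply τ hτ r₀ hr₀ u
  have main := hasDerivAt_integral_form (c := L.c₀.extend) h𝒟₀ hAs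
    L.c₀.extend.continuous.continuousOn
    (L.contDiffOn_c₀.continuousOn_derivWithin uniqueDiffOn_Icc_zero_one le_rfl)
    (fun s _ => L.extend_mem s) ht
  have hval : ∫ s in (0 : ℝ)..1,
        fderiv ℝ A (t, L.c₀.extend s) (1, 0) (derivWithin L.c₀.extend I s)
      = ∫ᶜ r in L.c t, β r := by
    rw [curveIntegral_def]
    refine intervalIntegral.integral_congr fun s hs => ?_
    rw [uIcc_of_le zero_le_one] at hs
    rw [L.curveIntegralFun_eq hφ h𝒟₀ ht _ hs, hpoint _ (L.extend_mem s)]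
  rw [hval] at main
  refine main.congr_of_eventuallyEq ?_
  filter_upwards [isOpen_Ioo.mem_nhds ht] with τ hτ
  rw [curveIntegral_def]
  refine intervalIntegral.integral_congr fun s hs => ?_
  rw [uIcc_of_le zero_le_one] at hs
  rw [L.curveIntegralFun_eq hφ h𝒟₀ hτ _ hs, hAapply τ hτ _ (L.extend_mem s)]

end Transport

/-! ### Smoothness of derived fields, and weak transport equations. -/

section SpaceTime

variable {a b : ℝ} {𝒟 : Set Plane} {F : Type*} [NormedAddCommGroup F] [NormedSpace ℝ F]

theorem contDiffOn_fderiv_slice {f : ℝ → Plane → F} (h𝒟 : IsOpen 𝒟)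
    (hf : ContDiffOn ℝ ∞ (uncurry f) (spaceTime a b 𝒟)) :
    ContDiffOn ℝ ∞ (fun x : ℝ × Plane => fderiv ℝ (f x.1) x.2) (spaceTime a b 𝒟) := by
  have h : ContDiffOn ℝ ∞ (fun x : ℝ × Plane =>
      (fderiv ℝ (uncurry f) x).comp (ContinuousLinearMap.inr ℝ ℝ Plane)) (spaceTime a b 𝒟) :=
    (hf.fderiv_of_isOpen (isOpen_spaceTime h𝒟) (by norm_cast)).clm_comp contDiffOn_const
  refine h.congr fun x hx => ?_
  exact (hasFDerivAt_slice ((hf.differentiableOn (by simp)).differentiableAt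
    ((isOpen_spaceTime h𝒟).mem_nhds hx))).fderiv

theorem contDiffOn_component {u : ℝ → Plane → Plane}
    (hu : ContDiffOn ℝ ∞ (uncurry u) (spaceTime a b 𝒟)) (i : Fin 2) :
    ContDiffOn ℝ ∞ (fun x : ℝ × Plane => u x.1 x.2 i) (spaceTime a b 𝒟) :=
  (EuclideanSpace.proj i : Plane →L[ℝ] ℝ).contDiff.comp_contDiffOn hu

theorem Fields.Smooth.w {S : Fields} (hs : S.Smooth a b 𝒟) (h𝒟 : IsOpen 𝒟) :
    ContDiffOn ℝ ∞ (uncurry S.w) (spaceTime a b 𝒟) := by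
  have h : ContDiffOn ℝ ∞ (fun x : ℝ × Plane => fderiv ℝ (uncurry S.ζ) x (1, S.v x.1 x.2))
      (spaceTime a b 𝒟) :=
    (hs.ζ.fderiv_of_isOpen (isOpen_spaceTime h𝒟) (by norm_cast)).clm_apply
      (contDiffOn_const.prodMk hs.v)
  refine h.congr fun x hx => ?_
  exact (fderiv_uncurry_one_mk (f := S.ζ) ((hs.ζ.differentiableOn (by simp)).differentiableAt
    ((isOpen_spaceTime h𝒟).mem_nhds hx)) _).symm

theorem isAddHaarMeasure_volume : (volume : Measure (ℝ × Plane)).IsAddHaarMeasure := by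
  rw [Measure.volume_eq_prod]; infer_instance

/-- A weak transport equation along a divergence-free velocity holds pointwise. -/
theorem eq_of_weak_transport {V : ℝ → Plane → Plane} (h𝒟 : IsOpen 𝒟)
    (hV : ContDiffOn ℝ ∞ (uncurry V) (spaceTime a b 𝒟))
    (hdiv : ∀ t ∈ Ioo a b, ∀ r ∈ 𝒟, divergence (V t) r = 0) {A m q : ℝ × Plane → ℝ}
    (e : Plane) (hA : ContinuousOn A (spaceTime a b 𝒟)) (hm : ContDiffOn ℝ 1 m (spaceTime a b 𝒟))
    (hq : ContDiffOn ℝ 1 q (spaceTime a b 𝒟))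
    (h : ∀ g : ℝ × Plane → ℝ, ContDiff ℝ ∞ g → HasCompactSupport g →
      tsupport g ⊆ spaceTime a b 𝒟 → ∫ x in tsupport g,
        (A x * g x + (m x * fderiv ℝ g x (1, V x.1 x.2) + q x * fderiv ℝ g x (0, e))) = 0)
    {t : ℝ} (ht : t ∈ Ioo a b) {r : Plane} (hr : r ∈ 𝒟) :
    A (t, r) = fderiv ℝ m (t, r) (1, V t r) + fderiv ℝ q (t, r) (0, e) := by
  have hVi : ∀ i, ContDiffOn ℝ 1 (fun x : ℝ × Plane => V x.1 x.2 i) (spaceTime a b 𝒟) := fun i =>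
    (contDiffOn_component hV i).of_le (by simp)
  have hsplit : ∀ u : Plane, ((1, u) : ℝ × Plane) = (1, 0)
      + (u 0 • ((0 : ℝ), EuclideanSpace.single 0 (1 : ℝ))
      + u 1 • ((0 : ℝ), EuclideanSpace.single 1 (1 : ℝ))) := fun u => by
    refine Prod.ext (by simp) ?_
    simpa using eq_single_add_single u
  have : (volume : Measure (ℝ × Plane)).IsAddHaarMeasure := isAddHaarMeasure_volume
  -- Splitting `(1, V)` into coordinate directions gives a conservation law with fluxes `m`, `m V₀`,
  -- `m V₁`, and `q` along `e`.
  have key := eq_sum_fderiv_of_weak (μ := (volume : Measure (ℝ × Plane)))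
    (isOpen_spaceTime (a := a) (b := b) h𝒟)
    (B := ![m, fun x => m x * V x.1 x.2 0, fun x => m x * V x.1 x.2 1, q])
    (e := ![(1, 0), (0, EuclideanSpace.single 0 1), (0, EuclideanSpace.single 1 1), (0, e)]) hA
    (fun i => by
      fin_cases i
      · exact hm
      · exact hm.mul (hVi 0)
      · exact hm.mul (hVi 1)
      · exact hq)
    (fun g hg hgc hgΩ => by
      refine Eq.trans ?_ (h g hg hgc hgΩ)
      congr 1
      ext x
      rw [hsplit (V x.1 x.2), Fin.sum_univ_four]
      simp only [Matrix.cons_val_zero, Matrix.cons_val_one, Matrix.cons_val, map_add, map_smul,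
        smul_eq_mul]
      ring)
    (t, r) ⟨ht, hr⟩
  have hnhds := (isOpen_spaceTime (a := a) (b := b) h𝒟).mem_nhds (mk_mem_spaceTime ht hr)
  have hmd := (hm.differentiableOn (by simp)).differentiableAt hnhds
  have hVd := (hV.differentiableOn (by simp)).differentiableAt hnhds
  have hprod : ∀ (i : Fin 2) (z : ℝ × Plane), fderiv ℝ (fun x => m x * V x.1 x.2 i) (t, r) z
      = m (t, r) * fderiv ℝ (uncurry V) (t, r) z i + V t r i * fderiv ℝ m (t, r) z := by
    intro i z
    have hi : HasFDerivAt (fun x : ℝ × Plane => V x.1 x.2 i)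
        ((EuclideanSpace.proj i : Plane →L[ℝ] ℝ).comp (fderiv ℝ (uncurry V) (t, r))) (t, r) :=
      (EuclideanSpace.proj i : Plane →L[ℝ] ℝ).hasFDerivAt.comp (t, r) hVd.hasFDerivAt
    have hmi : HasFDerivAt (fun x => m x * V x.1 x.2 i) _ (t, r) := hmd.hasFDerivAt.mul hi
    rw [hmi.fderiv]
    simp
  have hdiv0 := hdiv t ht r hr
  rw [divergence, Fin.sum_univ_two, fderiv_slice hVd, fderiv_slice hVd] at hdiv0
  rw [key, hsplit (V t r), Fin.sum_univ_four]
  simp only [Matrix.cons_val_zero, Matrix.cons_val_one, Matrix.cons_val, hprod, map_add, map_smul,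
    smul_eq_mul]
  -- `div (m V)` differs from `V · ∇m` by `m div V`, which is zero.
  linear_combination m (t, r) * hdiv0

end SpaceTime

/-! ### Consequences of the carried density and buoyancy. -/

section Kinematics

variable {a b : ℝ} {𝒟₀ 𝒟 : Set Plane} {φ : ℝ → Plane → Plane} {S : Fields}

/-- A density that stays equal to one is carried by a divergence-free velocity. -/
theorem IsCarriedBy.divergence_eq_zero (hc : IsCarriedBy a b 𝒟₀ φ S) (hφ : IsFlowMap a b 𝒟₀ 𝒟 φ)
    (hs : S.Smooth a b 𝒟) (h𝒟₀ : IsOpen 𝒟₀) (h𝒟 : IsOpen 𝒟)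
    (hD : ∀ t ∈ Ioo a b, ∀ r ∈ 𝒟, S.D t r = 1) {t : ℝ} (ht : t ∈ Ioo a b) {r : Plane}
    (hr : r ∈ 𝒟) : divergence (S.v t) r = 0 := by
  obtain ⟨r₀, hr₀, rfl⟩ := (hφ.bijOn t ht).surjOn hr
  obtain ⟨D₀, hD₀⟩ := hc.density
  have h1 := hφ.hasDerivAt_det h𝒟₀ h𝒟 (hs.v.of_le (by simp)) hc.velocity ht hr₀
  -- With `D = 1` the Jacobian equals `D₀`, hence is constant in time; Liouville's formula then
  -- forces the divergence to vanish because the Jacobian does not.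
  have h2 : HasDerivAt (fun τ => (fderiv ℝ (φ τ) r₀).det) 0 t := by
    refine (hasDerivAt_const t (D₀ r₀)).congr_of_eventuallyEq ?_
    filter_upwards [isOpen_Ioo.mem_nhds ht] with τ hτ
    rw [← hD₀ τ hτ r₀ hr₀, hD τ hτ _ (hφ.mem hτ hr₀), one_mul]
  exact (mul_eq_zero.1 (h1.unique h2)).resolve_right (hφ.det_ne_zero t ht r₀ hr₀)

/-- The buoyancy is constant along particle paths. -/
theorem IsCarriedBy.materialDeriv_buoyancy (hc : IsCarriedBy a b 𝒟₀ φ S)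
    (hφ : IsFlowMap a b 𝒟₀ 𝒟 φ) (hs : S.Smooth a b 𝒟) (h𝒟₀ : IsOpen 𝒟₀) (h𝒟 : IsOpen 𝒟)
    {t : ℝ} (ht : t ∈ Ioo a b) {r : Plane} (hr : r ∈ 𝒟) :
    fderiv ℝ (uncurry S.ρ) (t, r) (1, S.v t r) = 0 := by
  obtain ⟨r₀, hr₀, rfl⟩ := (hφ.bijOn t ht).surjOn hr
  obtain ⟨ρ₀, hρ₀⟩ := hc.buoyancy
  have hd : DifferentiableAt ℝ (uncurry S.ρ) (t, φ t r₀) :=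
    (hs.ρ.differentiableOn (by simp)).differentiableAt
      ((isOpen_spaceTime h𝒟).mem_nhds ⟨ht, hr⟩)
  have h1 := hasDerivAt_along (f := S.ρ) (x := fun τ => φ τ r₀) hd
    (hφ.hasDerivAt h𝒟₀ hc.velocity ht hr₀)
  refine h1.unique ((hasDerivAt_const t (ρ₀ r₀)).congr_of_eventuallyEq ?_)
  filter_upwards [isOpen_Ioo.mem_nhds ht] with τ hτ using hρ₀ τ hτ r₀ hr₀

end Kinematics

open Fields

/-! ### Pressure and elevation variations. -/

section Variations

variable {σ Fr ρref a b : ℝ} {𝒟 : Set Plane} {S : Fields}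

theorem spaceTime_mem_nhds (h𝒟 : IsOpen 𝒟) {x : ℝ × Plane} (hx : x ∈ spaceTime a b 𝒟) :
    spaceTime a b 𝒟 ∈ 𝓝 x := (isOpen_spaceTime h𝒟).mem_nhds hx

theorem Fields.vary_zero_displacement (S : Fields) (η π : ℝ → Plane → ℝ) (ε : ℝ) :
    S.vary (fun _ _ => 0) η π ε = { S with
      ζ := fun t r => S.ζ t r + ε * η t r
      p := fun t r => S.p t r + ε * π t r } := by
  simp [Fields.vary, timeDeriv, divergence]

/-- Stationarity of the action when its density is polynomial in the amplitude on the support of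
the variation. -/
theorem Fields.HamiltonPrinciple.integral_eq_zero (hH : S.HamiltonPrinciple σ Fr ρref a b 𝒟)
    {K : Set (ℝ × Plane)} (hK : IsCompact K) (hKΩ : K ⊆ spaceTime a b 𝒟)
    {ξ : ℝ → Plane → Plane} {η π : ℝ → Plane → ℝ}
    (hξ : ContDiff ℝ ∞ (uncurry ξ)) (hξK : tsupport (uncurry ξ) ⊆ K)
    (hη : ContDiff ℝ ∞ (uncurry η)) (hηK : tsupport (uncurry η) ⊆ K)
    (hπ : ContDiff ℝ ∞ (uncurry π)) (hπK : tsupport (uncurry π) ⊆ K)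
    {n : ℕ} {c : Fin (n + 2) → ℝ × Plane → ℝ} (hc : ∀ k, ContinuousOn (c k) K)
    (hL : ∀ᶠ ε in 𝓝 (0 : ℝ), ∀ x ∈ K,
      lagrangianDensity σ Fr ρref (S.vary ξ η π ε) x.1 x.2
        = ∑ k : Fin (n + 2), ε ^ (k : ℕ) * c k x) :
    ∫ x in K, c 1 x = 0 :=
  (hasDerivAt_setIntegral_polynomial hK hc hL).unique (hH K hK hKΩ ξ η π hξ hξK hη hηK hπ hπK)

theorem tsupport_uncurry_zero_subset {F : Type*} [Zero F] (K : Set (ℝ × Plane)) :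
    tsupport (uncurry fun (_ : ℝ) (_ : Plane) => (0 : F)) ⊆ K := by
  have : (uncurry fun (_ : ℝ) (_ : Plane) => (0 : F)) = fun _ => 0 := rfl
  rw [this]; simp

theorem continuousOn_lagrangianDensity (hs : S.Smooth a b 𝒟) (h𝒟 : IsOpen 𝒟)
    (hρ : ∀ t ∈ Ioo a b, ∀ r ∈ 𝒟, 0 < S.ρ t r) :
    ContinuousOn (fun x : ℝ × Plane => lagrangianDensity σ Fr ρref S x.1 x.2)
      (spaceTime a b 𝒟) := by
  have hv : ContinuousOn (fun x : ℝ × Plane => S.v x.1 x.2) (spaceTime a b 𝒟) := hs.v.continuousOn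
  have hζ : ContinuousOn (fun x : ℝ × Plane => S.ζ x.1 x.2) (spaceTime a b 𝒟) := hs.ζ.continuousOn
  have hD : ContinuousOn (fun x : ℝ × Plane => S.D x.1 x.2) (spaceTime a b 𝒟) := hs.D.continuousOn
  have hr : ContinuousOn (fun x : ℝ × Plane => S.ρ x.1 x.2) (spaceTime a b 𝒟) := hs.ρ.continuousOn
  have hp : ContinuousOn (fun x : ℝ × Plane => S.p x.1 x.2) (spaceTime a b 𝒟) := hs.p.continuousOn
  have hw : ContinuousOn (fun x : ℝ × Plane => S.w x.1 x.2) (spaceTime a b 𝒟) :=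
    (hs.w h𝒟).continuousOn
  have hq : ContinuousOn (fun x : ℝ × Plane => ρref / S.ρ x.1 x.2) (spaceTime a b 𝒟) :=
    continuousOn_const.div hr fun x hx => (hρ x.1 hx.1 x.2 hx.2).ne'
  unfold lagrangianDensity
  fun_prop

/-- The pressure variation imposes incompressibility. -/
theorem Fields.HamiltonPrinciple.density_eq_one (hH : S.HamiltonPrinciple σ Fr ρref a b 𝒟)
    (hs : S.Smooth a b 𝒟) (h𝒟 : IsOpen 𝒟) (hρ : ∀ t ∈ Ioo a b, ∀ r ∈ 𝒟, 0 < S.ρ t r) :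
    ∀ t ∈ Ioo a b, ∀ r ∈ 𝒟, S.D t r = 1 := by
  intro t ht r hr
  have hD : ContinuousOn (fun x : ℝ × Plane => S.D x.1 x.2) (spaceTime a b 𝒟) := hs.D.continuousOn
  have hA : ContinuousOn (fun x : ℝ × Plane => -(S.D x.1 x.2 - 1)) (spaceTime a b 𝒟) := by fun_prop
  have := isAddHaarMeasure_volume
  -- With the empty index type there are no fluxes, and the weak law is the plain fundamental lemma.
  have key := eq_sum_fderiv_of_weak (μ := (volume : Measure (ℝ × Plane))) (ι := Empty)
    (B := fun _ _ => 0) (e := fun _ => 0) (isOpen_spaceTime h𝒟) hA (fun i => i.elim)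
    (fun g hg hgc hgΩ => ?_) (t, r) ⟨ht, hr⟩
  · simp only [Finset.univ_eq_empty, Finset.sum_empty] at key
    linarith
  · have h1 := hH.integral_eq_zero (K := tsupport g) hgc hgΩ (ξ := fun _ _ => 0)
      (η := fun _ _ => 0) (π := fun t r => g (t, r)) contDiff_const
      (tsupport_uncurry_zero_subset _) contDiff_const (tsupport_uncurry_zero_subset _) hg subset_rfl
      (n := 0) (c := ![fun x => lagrangianDensity σ Fr ρref S x.1 x.2,
        fun x => -(S.D x.1 x.2 - 1) * g x]) (fun k => by
          fin_cases k
          · exact (continuousOn_lagrangianDensity hs h𝒟 hρ).mono hgΩ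
          · exact (hA.mono hgΩ).mul hg.continuous.continuousOn)
      (Eventually.of_forall fun ε x _ => by
        rw [Fields.vary_zero_displacement]
        simp [lagrangianDensity, Fields.w, timeDeriv, Fin.sum_univ_two]
        ring)
    simpa using h1

/-- The elevation variation gives the equation of vertical motion. -/
theorem Fields.HamiltonPrinciple.vertical_motion (hH : S.HamiltonPrinciple σ Fr ρref a b 𝒟)
    (hs : S.Smooth a b 𝒟) (h𝒟 : IsOpen 𝒟) (hFr : Fr ≠ 0) (hρ : ∀ t ∈ Ioo a b, ∀ r ∈ 𝒟, 0 < S.ρ t r)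
    (hdiv : ∀ t ∈ Ioo a b, ∀ r ∈ 𝒟, divergence (S.v t) r = 0)
    (hρt : ∀ t ∈ Ioo a b, ∀ r ∈ 𝒟, fderiv ℝ (uncurry S.ρ) (t, r) (1, S.v t r) = 0)
    {t : ℝ} (ht : t ∈ Ioo a b) {r : Plane} (hr : r ∈ 𝒟) :
    σ ^ 2 * S.ρ t r * fderiv ℝ (uncurry S.w) (t, r) (1, S.v t r)
      = -(ρref * S.ζ t r / Fr ^ 2) := by
  have hD := hH.density_eq_one hs h𝒟 hρ
  have hv : ContinuousOn (fun x : ℝ × Plane => S.v x.1 x.2) (spaceTime a b 𝒟) := hs.v.continuousOn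
  have hζ : ContinuousOn (fun x : ℝ × Plane => S.ζ x.1 x.2) (spaceTime a b 𝒟) := hs.ζ.continuousOn
  have hr' : ContinuousOn (fun x : ℝ × Plane => S.ρ x.1 x.2) (spaceTime a b 𝒟) := hs.ρ.continuousOn
  have hw : ContinuousOn (fun x : ℝ × Plane => S.w x.1 x.2) (spaceTime a b 𝒟) :=
    (hs.w h𝒟).continuousOn
  have hA : ContinuousOn (fun x : ℝ × Plane => -(ρref * S.ζ x.1 x.2 / Fr ^ 2))
      (spaceTime a b 𝒟) := by fun_prop
  have hm : ContDiffOn ℝ 1 (fun x : ℝ × Plane => σ ^ 2 * (S.w x.1 x.2 * S.ρ x.1 x.2))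
      (spaceTime a b 𝒟) :=
    contDiffOn_const.mul (((hs.w h𝒟).of_le (by simp)).mul (hs.ρ.of_le (by simp)))
  -- The vertical momentum density `σ² w ρ` is transported against the restoring force; the extra
  -- flux `q` is not needed here and is set to zero.
  have key := eq_of_weak_transport h𝒟 hs.v hdiv (q := fun _ => 0) 0 hA hm contDiffOn_const
    (fun g hg hgc hgΩ => ?_) ht hr
  · have hwd := ((hs.w h𝒟).differentiableOn (by simp)).differentiableAt
      (spaceTime_mem_nhds h𝒟 (mk_mem_spaceTime ht hr))
    have hρd := (hs.ρ.differentiableOn (by simp)).differentiableAt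
      (spaceTime_mem_nhds h𝒟 (mk_mem_spaceTime ht hr))
    have hmd : HasFDerivAt (fun x : ℝ × Plane => σ ^ 2 * (S.w x.1 x.2 * S.ρ x.1 x.2)) _ (t, r) :=
      (hwd.hasFDerivAt.mul hρd.hasFDerivAt).const_mul (σ ^ 2)
    rw [hmd.fderiv] at key
    have h0 := hρt t ht r hr
    have hq : fderiv ℝ (fun _ : ℝ × Plane => (0 : ℝ)) (t, r) (0, 0) = 0 := map_zero _
    rw [hq] at key
    -- Since `ρ` is materially constant, it comes out of the material derivative of `w ρ`.
    simp only [smul_apply, add_apply, smul_eq_mul, uncurry_apply_pair, h0] at key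
    linear_combination -key
  · have hG : ContinuousOn (fun x : ℝ × Plane => fderiv ℝ g x (1, S.v x.1 x.2))
        (spaceTime a b 𝒟) :=
      (hg.continuous_fderiv (by simp)).continuousOn.clm_apply (continuousOn_const.prodMk hv)
    have hgc' : ContinuousOn g (spaceTime a b 𝒟) := hg.continuous.continuousOn
    have h1 := hH.integral_eq_zero (K := tsupport g) hgc hgΩ (ξ := fun _ _ => 0)
      (η := fun t r => g (t, r)) (π := fun _ _ => 0) contDiff_const
      (tsupport_uncurry_zero_subset _) hg subset_rfl contDiff_const
      (tsupport_uncurry_zero_subset _)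
      -- The density is quadratic in `ε`, since `w` changes by `ε` times the material derivative of
      -- `g`. The factor `ρ` cancels `1 / ρ` in the potential term.
      (n := 1) (c := ![fun x => lagrangianDensity σ Fr ρref S x.1 x.2,
        fun x => -(ρref * S.ζ x.1 x.2 / Fr ^ 2) * g x
          + σ ^ 2 * (S.w x.1 x.2 * S.ρ x.1 x.2) * fderiv ℝ g x (1, S.v x.1 x.2),
        fun x => 1 / 2 * σ ^ 2 * fderiv ℝ g x (1, S.v x.1 x.2) ^ 2 * S.ρ x.1 x.2
          - ρref * g x ^ 2 / (2 * Fr ^ 2)]) (fun k => by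
          fin_cases k
          · exact (continuousOn_lagrangianDensity hs h𝒟 hρ).mono hgΩ
          · refine ContinuousOn.mono ?_ hgΩ
            exact (hA.mul hgc').add ((by fun_prop : ContinuousOn (fun x : ℝ × Plane =>
              σ ^ 2 * (S.w x.1 x.2 * S.ρ x.1 x.2)) _).mul hG)
          · refine ContinuousOn.mono ?_ hgΩ
            show ContinuousOn (fun x : ℝ × Plane =>
              1 / 2 * σ ^ 2 * fderiv ℝ g x (1, S.v x.1 x.2) ^ 2 * S.ρ x.1 x.2
                - ρref * g x ^ 2 / (2 * Fr ^ 2)) _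
            fun_prop)
      (Eventually.of_forall fun ε x hx => by
        obtain ⟨s, y⟩ := x
        have hxΩ := hgΩ hx
        have hζd : DifferentiableAt ℝ (uncurry S.ζ) (s, y) :=
          (hs.ζ.differentiableOn (by simp)).differentiableAt (spaceTime_mem_nhds h𝒟 hxΩ)
        have hgd : DifferentiableAt ℝ g (s, y) := hg.differentiable (by simp) _
        have hsum : HasFDerivAt (uncurry fun t r => S.ζ t r + ε * g (t, r))
            (fderiv ℝ (uncurry S.ζ) (s, y) + ε • fderiv ℝ g (s, y)) (s, y) :=
          hζd.hasFDerivAt.add (hgd.hasFDerivAt.const_mul ε)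
        have hw' : timeDeriv (fun t r => S.ζ t r + ε * g (t, r)) s y
            + fderiv ℝ (fun r => S.ζ s r + ε * g (s, r)) y (S.v s y)
            = S.w s y + ε * fderiv ℝ g (s, y) (1, S.v s y) := by
          rw [← fderiv_uncurry_one_mk (f := fun t r => S.ζ t r + ε * g (t, r))
            hsum.differentiableAt, hsum.fderiv, Fields.w, ← fderiv_uncurry_one_mk hζd]
          rfl
        have hρ0 : S.ρ s y ≠ 0 := (hρ s hxΩ.1 y hxΩ.2).ne'
        have hD1 : S.D s y = 1 := hD s hxΩ.1 y hxΩ.2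
        refine Eq.trans ?_ (Fin.sum_univ_three _).symm
        rw [Fields.vary_zero_displacement]
        simp only [lagrangianDensity, Fields.w, Matrix.cons_val_zero, Matrix.cons_val_one,
          Matrix.cons_val, hD1] at hw' ⊢
        rw [hw']
        simp
        field_simp
        ring)
    simpa using h1

end Variations

/-! ### Displacement variations. -/

section HorizontalMotion

variable {σ Fr ρref a b : ℝ} {𝒟 : Set Plane} {S : Fields}

/-- The Lagrangian density is a polynomial in the amplitude of a displacement, as long as the
varied buoyancy does not vanish. -/
theorem lagrangianDensity_vary_displacement {ξ : ℝ → Plane → Plane} {ε t D' ρ' : ℝ}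
    {r V' : Plane}
    (hV' : timeDeriv ξ t r + fderiv ℝ (ξ t) r (S.v t r) - fderiv ℝ (S.v t) r (ξ t r) = V')
    (hD' : -divergence (fun r' => S.D t r' • ξ t r') r = D')
    (hρ' : -fderiv ℝ (S.ρ t) r (ξ t r) = ρ') (hD : S.D t r = 1) (hρ : S.ρ t r + ε * ρ' ≠ 0) :
    lagrangianDensity σ Fr ρref (S.vary ξ (fun _ _ => 0) (fun _ _ => 0) ε) t r =
      ((‖S.v t r‖ ^ 2 + σ ^ 2 * S.w t r ^ 2) / 2
        + ε * (inner ℝ (S.v t r) V' + σ ^ 2 * S.w t r * fderiv ℝ (S.ζ t) r V')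
        + ε ^ 2 * ((‖V'‖ ^ 2 + σ ^ 2 * fderiv ℝ (S.ζ t) r V' ^ 2) / 2))
        * ((1 + ε * D') * (S.ρ t r + ε * ρ'))
      - (ρref * S.ζ t r ^ 2 / (2 * Fr ^ 2)) * (1 + ε * D') - S.p t r * (ε * D') := by
  have hw : (S.vary ξ (fun _ _ => 0) (fun _ _ => 0) ε).w t r
      = S.w t r + ε * fderiv ℝ (S.ζ t) r V' := by
    simp only [Fields.w, Fields.vary, mul_zero, add_zero, hV', map_add, map_smul, smul_eq_mul]
    rw [add_assoc]
  have hv : ‖S.v t r + ε • V'‖ ^ 2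
      = ‖S.v t r‖ ^ 2 + 2 * (ε * inner ℝ (S.v t r) V') + ε ^ 2 * ‖V'‖ ^ 2 := by
    rw [norm_add_sq_real, real_inner_smul_right, norm_smul, mul_pow, Real.norm_eq_abs, sq_abs]
  rw [lagrangianDensity, hw]
  simp only [Fields.vary, hV', hD', hρ', hD, hv, mul_zero, add_zero]
  -- The varied buoyancy in the denominator is the only non-polynomial dependence on `ε`, and the
  -- mass factor cancels it.
  have hcancel : ρref / (S.ρ t r + ε * ρ') * (S.ζ t r ^ 2 / (2 * Fr ^ 2))
      * ((1 + ε * D') * (S.ρ t r + ε * ρ'))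
      = (ρref * S.ζ t r ^ 2 / (2 * Fr ^ 2)) * (1 + ε * D') := by
    field_simp
  rw [sub_mul, hcancel]
  ring

/-- By compactness `f' / f` is bounded on `K`, while a zero would force `ε * (f' x / f x) = -1`.
This keeps the varied buoyancy nonzero on the whole support at once. -/
theorem eventually_forall_add_mul_ne_zero {E : Type*} [TopologicalSpace E] {K : Set E}
    (hK : IsCompact K) {f f' : E → ℝ} (hf : ContinuousOn f K) (hf' : ContinuousOn f' K)
    (hpos : ∀ x ∈ K, 0 < f x) : ∀ᶠ ε in 𝓝 (0 : ℝ), ∀ x ∈ K, f x + ε * f' x ≠ 0 := by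
  obtain ⟨C, hC⟩ := hK.exists_bound_of_continuousOn
    (hf'.div hf fun x hx => (hpos x hx).ne')
  have hC1 : (0 : ℝ) < 1 / (|C| + 1) := by positivity
  filter_upwards [Metric.ball_mem_nhds (0 : ℝ) hC1] with ε hε x hx h0
  rw [mem_ball_zero_iff, Real.norm_eq_abs, lt_div_iff₀ (by positivity)] at hε
  have h1 : ε * (f' x / f x) = -1 := by
    have := (hpos x hx).ne'
    field_simp
    linarith
  have h2 := congrArg abs h1
  rw [abs_mul, abs_neg, abs_one] at h2
  have h3 : |f' x / f x| ≤ |C| := (hC x hx).trans (le_abs_self C)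
  nlinarith [abs_nonneg ε]

/-- The displacement variation gives the equation of horizontal motion. -/
theorem Fields.HamiltonPrinciple.horizontal_motion (hH : S.HamiltonPrinciple σ Fr ρref a b 𝒟)
    (hs : S.Smooth a b 𝒟) (h𝒟 : IsOpen 𝒟) (hρ : ∀ t ∈ Ioo a b, ∀ r ∈ 𝒟, 0 < S.ρ t r)
    (hdiv : ∀ t ∈ Ioo a b, ∀ r ∈ 𝒟, divergence (S.v t) r = 0)
    {t : ℝ} (ht : t ∈ Ioo a b) {r : Plane} (hr : r ∈ 𝒟) (i : Fin 2) :
    -(S.ρ t r * (inner ℝ (S.v t r) (fderiv ℝ (S.v t) r (EuclideanSpace.single i 1))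
        + σ ^ 2 * S.w t r
          * fderiv ℝ (S.ζ t) r (fderiv ℝ (S.v t) r (EuclideanSpace.single i 1))))
      - S.totalKinetic σ t r * fderiv ℝ (S.ρ t) r (EuclideanSpace.single i 1)
    = fderiv ℝ (fun x : ℝ × Plane => S.ρ x.1 x.2 * (S.v x.1 x.2 i
        + σ ^ 2 * S.w x.1 x.2 * fderiv ℝ (S.ζ x.1) x.2 (EuclideanSpace.single i 1)))
        (t, r) (1, S.v t r)
      + fderiv ℝ (fun x : ℝ × Plane => S.totalPressure Fr ρref x.1 x.2
        - S.totalKinetic σ x.1 x.2 * S.ρ x.1 x.2) (t, r) (0, EuclideanSpace.single i 1) := by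
  have hD := hH.density_eq_one hs h𝒟 hρ
  set e : Plane := EuclideanSpace.single i 1 with he
  have hv : ContDiffOn ℝ ∞ (fun x : ℝ × Plane => S.v x.1 x.2) (spaceTime a b 𝒟) := hs.v
  have hζ : ContDiffOn ℝ ∞ (fun x : ℝ × Plane => S.ζ x.1 x.2) (spaceTime a b 𝒟) := hs.ζ
  have hr' : ContDiffOn ℝ ∞ (fun x : ℝ × Plane => S.ρ x.1 x.2) (spaceTime a b 𝒟) := hs.ρ
  have hp : ContDiffOn ℝ ∞ (fun x : ℝ × Plane => S.p x.1 x.2) (spaceTime a b 𝒟) := hs.p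
  have hw : ContDiffOn ℝ ∞ (fun x : ℝ × Plane => S.w x.1 x.2) (spaceTime a b 𝒟) := hs.w h𝒟
  have hvi : ContDiffOn ℝ ∞ (fun x : ℝ × Plane => S.v x.1 x.2 i) (spaceTime a b 𝒟) :=
    contDiffOn_component hs.v i
  have hdζ := contDiffOn_fderiv_slice h𝒟 hs.ζ
  have hdζe : ContDiffOn ℝ ∞ (fun x : ℝ × Plane => fderiv ℝ (S.ζ x.1) x.2 e)
    (spaceTime a b 𝒟) := hdζ.clm_apply contDiffOn_const
  have hdve : ContDiffOn ℝ ∞ (fun x : ℝ × Plane => fderiv ℝ (S.v x.1) x.2 e)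
    (spaceTime a b 𝒟) := (contDiffOn_fderiv_slice h𝒟 hs.v).clm_apply contDiffOn_const
  have hdρe : ContDiffOn ℝ ∞ (fun x : ℝ × Plane => fderiv ℝ (S.ρ x.1) x.2 e)
    (spaceTime a b 𝒟) := (contDiffOn_fderiv_slice h𝒟 hs.ρ).clm_apply contDiffOn_const
  have hkin : ContDiffOn ℝ ∞ (fun x : ℝ × Plane => S.totalKinetic σ x.1 x.2)
      (spaceTime a b 𝒟) :=
    ((hv.norm_sq ℝ).add (contDiffOn_const.mul (hw.pow 2))).div_const 2
  have hpot : ContDiffOn ℝ ∞ (fun x : ℝ × Plane => ρref * S.ζ x.1 x.2 ^ 2 / (2 * Fr ^ 2))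
      (spaceTime a b 𝒟) := (contDiffOn_const.mul (hζ.pow 2)).div_const _
  have hA : ContinuousOn (fun x : ℝ × Plane =>
      -(S.ρ x.1 x.2 * (inner ℝ (S.v x.1 x.2) (fderiv ℝ (S.v x.1) x.2 e)
        + σ ^ 2 * S.w x.1 x.2 * fderiv ℝ (S.ζ x.1) x.2 (fderiv ℝ (S.v x.1) x.2 e)))
      - S.totalKinetic σ x.1 x.2 * fderiv ℝ (S.ρ x.1) x.2 e) (spaceTime a b 𝒟) :=
    ((hr'.mul ((hv.inner ℝ hdve).add ((contDiffOn_const.mul hw).mul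
      (hdζ.clm_apply hdve)))).neg.sub (hkin.mul hdρe)).continuousOn
  have hm := hr'.mul (hvi.add ((contDiffOn_const (c := σ ^ 2)).mul hw |>.mul hdζe))
  have hq := (hp.add hpot).sub (hkin.mul hr')
  refine eq_of_weak_transport h𝒟 hs.v hdiv e hA (hm.of_le (by simp)) (hq.of_le (by simp))
    (fun g hg hgc hgΩ => ?_) ht hr
  -- For `ξ = g e`, the functions `V'`, `D'`, `ρ'` are the induced variations of `v`, `D`, `ρ` on
  -- `(a, b) × 𝒟`, where `D = 1`; `G` is the material derivative of `g`.
  obtain ⟨G, hGdef⟩ : ∃ G : ℝ × Plane → ℝ, G = fun x => fderiv ℝ g x (1, S.v x.1 x.2) :=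
    ⟨_, rfl⟩
  obtain ⟨V', hV'def⟩ : ∃ V' : ℝ × Plane → Plane,
    V' = fun x => G x • e - g x • fderiv ℝ (S.v x.1) x.2 e := ⟨_, rfl⟩
  obtain ⟨D', hD'def⟩ : ∃ D' : ℝ × Plane → ℝ, D' = fun x => -fderiv ℝ g x (0, e) := ⟨_, rfl⟩
  obtain ⟨ρ', hρ'def⟩ : ∃ ρ' : ℝ × Plane → ℝ,
    ρ' = fun x => -(g x * fderiv ℝ (S.ρ x.1) x.2 e) := ⟨_, rfl⟩
  have hgc' : ContinuousOn g (spaceTime a b 𝒟) := hg.continuous.continuousOn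
  have hdg : ContinuousOn (fderiv ℝ g) (spaceTime a b 𝒟) :=
    (hg.continuous_fderiv (by simp)).continuousOn
  have hG : ContinuousOn G (spaceTime a b 𝒟) := by
    rw [hGdef]; exact hdg.clm_apply (continuousOn_const.prodMk hv.continuousOn)
  have hV' : ContinuousOn V' (spaceTime a b 𝒟) := by
    rw [hV'def]; exact (hG.smul continuousOn_const).sub (hgc'.smul hdve.continuousOn)
  have hD' : ContinuousOn D' (spaceTime a b 𝒟) := by
    rw [hD'def]; exact (hdg.clm_apply continuousOn_const).neg
  have hρ' : ContinuousOn ρ' (spaceTime a b 𝒟) := by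
    rw [hρ'def]; exact (hgc'.mul hdρe.continuousOn).neg
  -- `k₁` and `k₂` are the coefficients of `ε` and `ε²` in the kinetic energy per unit mass.
  obtain ⟨k₁, hk₁def⟩ : ∃ k₁ : ℝ × Plane → ℝ, k₁ = fun x => inner ℝ (S.v x.1 x.2) (V' x)
    + σ ^ 2 * S.w x.1 x.2 * fderiv ℝ (S.ζ x.1) x.2 (V' x) := ⟨_, rfl⟩
  obtain ⟨k₂, hk₂def⟩ : ∃ k₂ : ℝ × Plane → ℝ, k₂ = fun x => (‖V' x‖ ^ 2
    + σ ^ 2 * fderiv ℝ (S.ζ x.1) x.2 (V' x) ^ 2) / 2 := ⟨_, rfl⟩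
  have hW' : ContinuousOn (fun x : ℝ × Plane => fderiv ℝ (S.ζ x.1) x.2 (V' x))
    (spaceTime a b 𝒟) := hdζ.continuousOn.clm_apply hV'
  have hk₁ : ContinuousOn k₁ (spaceTime a b 𝒟) := by
    rw [hk₁def]
    exact (hv.continuousOn.inner hV').add ((continuousOn_const.mul hw.continuousOn).mul hW')
  have hk₂ : ContinuousOn k₂ (spaceTime a b 𝒟) := by
    rw [hk₂def]
    exact ((hV'.norm.pow 2).add (continuousOn_const.mul (hW'.pow 2))).div_const 2
  have hk₀ := hkin.continuousOn
  have hrc := hr'.continuousOn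
  have hpc := hp.continuousOn
  have hpotc := hpot.continuousOn
  have hnz := eventually_forall_add_mul_ne_zero (K := tsupport g) hgc (hrc.mono hgΩ)
    (hρ'.mono hgΩ) fun x hx => hρ x.1 (hgΩ hx).1 x.2 (hgΩ hx).2
  have hξ : ContDiff ℝ ∞ (uncurry fun (t : ℝ) (r : Plane) => g (t, r) • e) :=
    hg.smul contDiff_const
  have hξsupp : tsupport (uncurry fun (t : ℝ) (r : Plane) => g (t, r) • e) ⊆ tsupport g :=
    closure_mono fun x hx h0 => hx (by
      show g (x.1, x.2) • e = 0
      rw [Prod.mk.eta, h0, zero_smul])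
  have h1 := hH.integral_eq_zero (K := tsupport g) hgc hgΩ (ξ := fun t r => g (t, r) • e)
    (η := fun _ _ => 0) (π := fun _ _ => 0) hξ hξsupp contDiff_const
    (tsupport_uncurry_zero_subset _) contDiff_const (tsupport_uncurry_zero_subset _)
    -- The kinetic energy and the mass factor `(1 + ε D') (ρ + ε ρ')` are both quadratic, so the
    -- degree is four and there are five coefficients.
    (n := 3) (c := ![
      fun x => S.totalKinetic σ x.1 x.2 * S.ρ x.1 x.2 - ρref * S.ζ x.1 x.2 ^ 2 / (2 * Fr ^ 2),
      fun x => k₁ x * S.ρ x.1 x.2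
        + S.totalKinetic σ x.1 x.2 * (D' x * S.ρ x.1 x.2 + ρ' x)
        - ρref * S.ζ x.1 x.2 ^ 2 / (2 * Fr ^ 2) * D' x - S.p x.1 x.2 * D' x,
      fun x => k₂ x * S.ρ x.1 x.2 + k₁ x * (D' x * S.ρ x.1 x.2 + ρ' x)
        + S.totalKinetic σ x.1 x.2 * (D' x * ρ' x),
      fun x => k₂ x * (D' x * S.ρ x.1 x.2 + ρ' x) + k₁ x * (D' x * ρ' x),
      fun x => k₂ x * (D' x * ρ' x)]) (fun k => by
        refine ContinuousOn.mono ?_ hgΩ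
        have hM := (hD'.mul hrc).add hρ'
        have hM' := hD'.mul hρ'
        fin_cases k
        · exact (hk₀.mul hrc).sub hpotc
        · exact (((hk₁.mul hrc).add (hk₀.mul hM)).sub (hpotc.mul hD')).sub (hpc.mul hD')
        · exact ((hk₂.mul hrc).add (hk₁.mul hM)).add (hk₀.mul hM')
        · exact (hk₂.mul hM).add (hk₁.mul hM')
        · exact hk₂.mul hM')
    (by
      filter_upwards [hnz] with ε hε x hx
      refine Eq.trans ?_ (Fin.sum_univ_five _).symm
      obtain ⟨s, y⟩ := x
      have hxΩ := hgΩ hx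
      have hgd : DifferentiableAt ℝ g (s, y) := hg.differentiable (by simp) _
      have hξd : HasFDerivAt (uncurry fun (t : ℝ) (r : Plane) => g (t, r) • e)
          ((fderiv ℝ g (s, y)).smulRight e) (s, y) := hgd.hasFDerivAt.smul_const e
      have hξy : HasFDerivAt (fun r => g (s, r) • e)
          (((fderiv ℝ g (s, y)).smulRight e).comp (ContinuousLinearMap.inr ℝ ℝ Plane)) y :=
        hξd.fderiv ▸ hasFDerivAt_slice (f := fun t r => g (t, r) • e) hξd.differentiableAt
      rw [lagrangianDensity_vary_displacement (V' := V' (s, y)) (D' := D' (s, y))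
        (ρ' := ρ' (s, y)) ?_ ?_ ?_ (hD s hxΩ.1 y hxΩ.2) (hε (s, y) hx)]
      · simp only [Matrix.cons_val_zero, Matrix.cons_val_one, Matrix.cons_val, hk₁def, hk₂def,
          totalKinetic]
        simp
        ring
      · rw [← fderiv_uncurry_one_mk (f := fun t r => g (t, r) • e) hξd.differentiableAt,
          hξd.fderiv, hV'def, hGdef]
        simp
      -- `D` stands under the divergence, so `D = 1` is used on a neighbourhood of the point.
      · have hev : (fun r' => S.D s r' • g (s, r') • e) =ᶠ[𝓝 y] fun r' => g (s, r') • e := by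
          filter_upwards [h𝒟.mem_nhds hxΩ.2] with r' hr'
          rw [hD s hxΩ.1 r' hr', one_smul]
        rw [divergence, hev.fderiv_eq, hξy.fderiv, hD'def]
        simp [he]
      · rw [hρ'def]
        simp)
  -- Sorted by `g`, `G` and `∂_e g`, the linear coefficient is the integrand of the weak transport
  -- equation.
  refine Eq.trans ?_ h1
  congr 1
  ext x
  simp only [Matrix.cons_val_one, Matrix.cons_val_zero, hk₁def, hV'def, hD'def, hρ'def, hGdef,
    inner_sub_right, real_inner_smul_right, map_sub, map_smul, smul_eq_mul]
  have hie : inner ℝ (S.v x.1 x.2) e = S.v x.1 x.2 i := by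
    rw [he, EuclideanSpace.inner_single_right]; simp
  rw [hie]
  ring

end HorizontalMotion

/-! ### Transport of the momentum forms, and closedness of the baroclinic form. -/

section Circulation

variable {σ Fr ρref a b : ℝ} {𝒟₀ 𝒟 : Set Plane} {φ : ℝ → Plane → Plane} {S : Fields}

theorem clm_ext_single {A B : Plane →L[ℝ] ℝ}
    (h : ∀ i : Fin 2, A (EuclideanSpace.single i 1) = B (EuclideanSpace.single i 1)) : A = B := by
  ext u
  rw [eq_single_add_single u]
  simp only [map_add, map_smul, h]

theorem contDiffAt_slice {F : Type*} [NormedAddCommGroup F] [NormedSpace ℝ F] {f : ℝ → Plane → F}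
    (h𝒟 : IsOpen 𝒟) (hf : ContDiffOn ℝ ∞ (uncurry f) (spaceTime a b 𝒟)) {t : ℝ}
    (ht : t ∈ Ioo a b) {r : Plane} (hr : r ∈ 𝒟) : ContDiffAt ℝ ∞ (f t) r :=
  (hf.contDiffAt (spaceTime_mem_nhds h𝒟 (mk_mem_spaceTime ht hr))).comp r
    (f := fun r : Plane => (t, r)) (by fun_prop)

theorem Fields.Smooth.currentForm (hs : S.Smooth a b 𝒟) :
    ContDiffOn ℝ ∞ (uncurry S.currentForm) (spaceTime a b 𝒟) :=
  (innerSL ℝ (E := Plane)).contDiff.comp_contDiffOn hs.v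

theorem Fields.Smooth.waveForm (hs : S.Smooth a b 𝒟) (h𝒟 : IsOpen 𝒟) :
    ContDiffOn ℝ ∞ (uncurry (S.waveForm σ)) (spaceTime a b 𝒟) :=
  (contDiffOn_const.mul (hs.w h𝒟)).smul (contDiffOn_fderiv_slice h𝒟 hs.ζ)

/-- The material derivative commutes with the gradient, as a Lie derivative:
`(∂_t + ℒ_v) dζ = dw`. -/
theorem Fields.Smooth.materialDeriv_gradient (hs : S.Smooth a b 𝒟) (h𝒟 : IsOpen 𝒟) {t : ℝ}
    (ht : t ∈ Ioo a b) {r : Plane} (hr : r ∈ 𝒟) (u : Plane) :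
    fderiv ℝ (fun x : ℝ × Plane => fderiv ℝ (S.ζ x.1) x.2) (t, r) (1, S.v t r) u
      + fderiv ℝ (S.ζ t) r (fderiv ℝ (S.v t) r u) = fderiv ℝ (S.w t) r u := by
  have hnhds := spaceTime_mem_nhds h𝒟 (mk_mem_spaceTime ht hr)
  have hζ := hs.ζ.contDiffAt hnhds
  have hζd := hζ.differentiableAt (by simp)
  have hvd := (hs.v.differentiableOn (by simp)).differentiableAt hnhds
  have hwd := ((hs.w h𝒟).differentiableOn (by simp)).differentiableAt hnhds
  have hdd : DifferentiableAt ℝ (fderiv ℝ (uncurry S.ζ)) (t, r) :=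
    (hζ.fderiv_right (m := 1) (by norm_cast)).differentiableAt (by simp)
  have hd : ∀ x ∈ spaceTime a b 𝒟, DifferentiableAt ℝ (uncurry S.ζ) x := fun x hx =>
    (hs.ζ.differentiableOn (by simp)).differentiableAt (spaceTime_mem_nhds h𝒟 hx)
  -- `h1` and `h2` compute one differential twice, linking the derivative of the spatial gradient to
  -- the second space-time derivative of `ζ`, which is symmetric.
  have h1 : HasFDerivAt (fun x : ℝ × Plane => fderiv ℝ (S.ζ x.1) x.2 u)
      ((fderiv ℝ (fderiv ℝ (uncurry S.ζ)) (t, r)).flip (0, u)) (t, r) := by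
    have := hdd.hasFDerivAt.clm_apply (hasFDerivAt_const ((0, u) : ℝ × Plane) (t, r))
    rw [ContinuousLinearMap.comp_zero, zero_add] at this
    refine this.congr_of_eventuallyEq ?_
    filter_upwards [hnhds] with x hx
    exact fderiv_slice (f := S.ζ) (hd x hx) u
  have h2 : HasFDerivAt (fun x : ℝ × Plane => fderiv ℝ (S.ζ x.1) x.2 u)
      ((fderiv ℝ (fun x : ℝ × Plane => fderiv ℝ (S.ζ x.1) x.2) (t, r)).flip u) (t, r) := by
    have := (((contDiffOn_fderiv_slice h𝒟 hs.ζ).differentiableOn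
      (by simp)).differentiableAt hnhds).hasFDerivAt.clm_apply (hasFDerivAt_const u (t, r))
    rwa [ContinuousLinearMap.comp_zero, zero_add] at this
  have h3 : HasFDerivAt (uncurry S.w) ((fderiv ℝ (uncurry S.ζ) (t, r)).comp
        ((0 : ℝ × Plane →L[ℝ] ℝ).prod (fderiv ℝ (uncurry S.v) (t, r)))
      + (fderiv ℝ (fderiv ℝ (uncurry S.ζ)) (t, r)).flip (1, S.v t r)) (t, r) := by
    have := hdd.hasFDerivAt.clm_apply
      ((hasFDerivAt_const (1 : ℝ) (t, r)).prodMk hvd.hasFDerivAt)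
    refine this.congr_of_eventuallyEq ?_
    filter_upwards [hnhds] with x hx
    exact (fderiv_uncurry_one_mk (f := S.ζ) (hd x hx) _).symm
  -- Exchanging the material direction with `u` produces one part of `dw`; the other part, from the
  -- variation of `v` in `w`, is the term `dζ (∇v u)`.
  have hsymm := (hζ.isSymmSndFDerivAt (by simp; norm_cast)).eq (1, S.v t r) (0, u)
  have h12 := congrArg (fun A => A (1, S.v t r)) (h2.unique h1)
  simp only [ContinuousLinearMap.flip_apply] at h12
  rw [h12, hsymm, fderiv_slice hζd, fderiv_slice hvd, fderiv_slice hwd, h3.fderiv]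
  simp [add_comm]

/-- The wave momentum per unit mass is transported as the wave equation prescribes. -/
theorem IsSolution.waveForm_transport (hS : IsSolution σ Fr ρref a b 𝒟₀ 𝒟 φ S) (hFr : Fr ≠ 0)
    (h𝒟₀ : IsOpen 𝒟₀) (h𝒟 : IsOpen 𝒟) {t : ℝ} (ht : t ∈ Ioo a b) {r : Plane} (hr : r ∈ 𝒟) :
    fderiv ℝ (uncurry (S.waveForm σ)) (t, r) (1, S.v t r)
      + (S.waveForm σ t r).comp (fderiv ℝ (S.v t) r)
    = -((S.ρ t r)⁻¹ • fderiv ℝ (fun r' => ρref * S.ζ t r' ^ 2 / (2 * Fr ^ 2)) r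
      - fderiv ℝ (fun r' => σ ^ 2 * S.w t r' ^ 2 / 2) r) := by
  have hs := hS.smooth
  have hD := hS.hamilton.density_eq_one hs h𝒟 hS.buoyancy_pos
  have hvert := hS.hamilton.vertical_motion hs h𝒟 hFr hS.buoyancy_pos
    (fun t ht r hr => hS.carried.divergence_eq_zero hS.flow hs h𝒟₀ h𝒟 hD ht hr)
    (fun t ht r hr => hS.carried.materialDeriv_buoyancy hS.flow hs h𝒟₀ h𝒟 ht hr) ht hr
  have hnhds := spaceTime_mem_nhds h𝒟 (mk_mem_spaceTime ht hr)
  have hwd := ((hs.w h𝒟).differentiableOn (by simp)).differentiableAt hnhds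
  have hgd := ((contDiffOn_fderiv_slice h𝒟 hs.ζ).differentiableOn (by simp)).differentiableAt
    hnhds
  have hW : HasFDerivAt (uncurry (S.waveForm σ)) _ (t, r) :=
    (hwd.hasFDerivAt.const_mul (σ ^ 2)).smul hgd.hasFDerivAt
  have hζt : HasFDerivAt (S.ζ t) (fderiv ℝ (S.ζ t) r) r :=
    ((contDiffAt_slice h𝒟 hs.ζ ht hr).differentiableAt (by simp)).hasFDerivAt
  have hwt : HasFDerivAt (S.w t) (fderiv ℝ (S.w t) r) r :=
    ((contDiffAt_slice h𝒟 (hs.w h𝒟) ht hr).differentiableAt (by simp)).hasFDerivAt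
  have hpot : HasFDerivAt (fun r' => ρref * S.ζ t r' ^ 2 / (2 * Fr ^ 2))
      ((ρref * S.ζ t r / Fr ^ 2) • fderiv ℝ (S.ζ t) r) r := by
    refine (((hζt.pow 2).const_mul ρref).mul_const (2 * Fr ^ 2)⁻¹).congr_fderiv ?_
    ext u; simp; field_simp
  have hkin : HasFDerivAt (fun r' => σ ^ 2 * S.w t r' ^ 2 / 2)
      ((σ ^ 2 * S.w t r) • fderiv ℝ (S.w t) r) r := by
    refine (((hwt.pow 2).const_mul (σ ^ 2)).mul_const (2 : ℝ)⁻¹).congr_fderiv ?_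
    ext u; simp; ring
  rw [hW.fderiv, hpot.fderiv, hkin.fderiv]
  ext u
  have hu := hs.materialDeriv_gradient h𝒟 ht hr u
  have hρ0 := (hS.buoyancy_pos t ht r hr).ne'
  -- Multiplied by `dζ`, this is the potential term, as `ζ dζ = d (ζ² / 2)`. The remaining `σ² w
  -- (∂_t + ℒ) dζ = σ² w dw` is the kinetic term.
  have hDw : σ ^ 2 * fderiv ℝ (uncurry S.w) (t, r) (1, S.v t r)
      = -((S.ρ t r)⁻¹ * (ρref * S.ζ t r / Fr ^ 2)) := by
    field_simp at hvert ⊢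
    linear_combination hvert
  simp only [waveForm, uncurry_apply_pair, add_apply, smul_apply, ContinuousLinearMap.comp_apply,
    ContinuousLinearMap.smulRight_apply, smul_eq_mul, neg_apply, sub_apply, ← hu]
  linear_combination fderiv ℝ (S.ζ t) r u * hDw

/-- The total momentum per unit mass is transported as Hamilton's principle prescribes. -/
theorem IsSolution.totalForm_transport (hS : IsSolution σ Fr ρref a b 𝒟₀ 𝒟 φ S)
    (h𝒟₀ : IsOpen 𝒟₀) (h𝒟 : IsOpen 𝒟) {t : ℝ} (ht : t ∈ Ioo a b) {r : Plane} (hr : r ∈ 𝒟) :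
    fderiv ℝ (uncurry fun t r => S.currentForm t r + S.waveForm σ t r) (t, r) (1, S.v t r)
      + (S.currentForm t r + S.waveForm σ t r).comp (fderiv ℝ (S.v t) r)
    = -((S.ρ t r)⁻¹ • fderiv ℝ (S.totalPressure Fr ρref t) r
      - fderiv ℝ (S.totalKinetic σ t) r) := by
  have hs := hS.smooth
  have hD := hS.hamilton.density_eq_one hs h𝒟 hS.buoyancy_pos
  have hρt := hS.carried.materialDeriv_buoyancy hS.flow hs h𝒟₀ h𝒟 ht hr
  have hρ0 := (hS.buoyancy_pos t ht r hr).ne'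
  have hnhds := spaceTime_mem_nhds h𝒟 (mk_mem_spaceTime ht hr)
  have hMs : ContDiffOn ℝ ∞ (uncurry fun t r => S.currentForm t r + S.waveForm σ t r)
    (spaceTime a b 𝒟) := hs.currentForm.add (hs.waveForm h𝒟)
  have hMd := (hMs.differentiableOn (by simp)).differentiableAt hnhds
  have hρd := (hs.ρ.differentiableOn (by simp)).differentiableAt hnhds
  have hkin : ContDiffOn ℝ ∞ (uncurry (S.totalKinetic σ)) (spaceTime a b 𝒟) :=
    ((hs.v.norm_sq ℝ).add (contDiffOn_const.mul ((hs.w h𝒟).pow 2))).div_const 2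
  have hpres : ContDiffOn ℝ ∞ (uncurry (S.totalPressure Fr ρref)) (spaceTime a b 𝒟) :=
    hs.p.add ((contDiffOn_const.mul (hs.ζ.pow 2)).div_const _)
  have hkd := (hkin.differentiableOn (by simp)).differentiableAt hnhds
  have hpd := (hpres.differentiableOn (by simp)).differentiableAt hnhds
  refine clm_ext_single fun i => ?_
  have key := hS.hamilton.horizontal_motion hs h𝒟 hS.buoyancy_pos
    (fun t ht r hr => hS.carried.divergence_eq_zero hS.flow hs h𝒟₀ h𝒟 hD ht hr) ht hr i
  have hm : HasFDerivAt (fun x : ℝ × Plane => S.ρ x.1 x.2 * (S.v x.1 x.2 i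
      + σ ^ 2 * S.w x.1 x.2 * fderiv ℝ (S.ζ x.1) x.2 (EuclideanSpace.single i 1)))
      (S.ρ t r • (fderiv ℝ (uncurry fun t r => S.currentForm t r + S.waveForm σ t r) (t, r)).flip
          (EuclideanSpace.single i 1)
        + (S.currentForm t r + S.waveForm σ t r) (EuclideanSpace.single i 1)
          • fderiv ℝ (uncurry S.ρ) (t, r)) (t, r) := by
    have h1 := hMd.hasFDerivAt.clm_apply
      (hasFDerivAt_const (EuclideanSpace.single i (1 : ℝ) : Plane) (t, r))
    rw [ContinuousLinearMap.comp_zero, zero_add] at h1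
    refine (hρd.hasFDerivAt.mul h1).congr_of_eventuallyEq (Eventually.of_forall fun x => ?_)
    show S.ρ x.1 x.2 * _ = S.ρ x.1 x.2 * ((S.currentForm x.1 x.2 + S.waveForm σ x.1 x.2) _)
    rw [add_apply, currentForm, innerSL_apply_apply, EuclideanSpace.inner_single_right]
    simp [waveForm]
  have hq : HasFDerivAt (fun x : ℝ × Plane => S.totalPressure Fr ρref x.1 x.2
      - S.totalKinetic σ x.1 x.2 * S.ρ x.1 x.2) (fderiv ℝ (uncurry (S.totalPressure Fr ρref)) (t, r)
        - (S.totalKinetic σ t r • fderiv ℝ (uncurry S.ρ) (t, r)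
          + S.ρ t r • fderiv ℝ (uncurry (S.totalKinetic σ)) (t, r))) (t, r) :=
    hpd.hasFDerivAt.sub (hkd.hasFDerivAt.mul hρd.hasFDerivAt)
  -- The term `-ϖ dρ` from the flux, with `ϖ` the total kinetic energy, cancels the one produced by
  -- `δρ`. As `ρ` is materially constant, everything left of the momentum balance can be divided by
  -- `ρ`.
  rw [hm.fderiv, hq.fderiv] at key
  simp only [add_apply, sub_apply, smul_apply, ContinuousLinearMap.flip_apply, smul_eq_mul, hρt,
    ← fderiv_slice hρd, ← fderiv_slice hpd, ← fderiv_slice hkd] at key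
  simp only [add_apply, sub_apply, smul_apply, neg_apply, ContinuousLinearMap.comp_apply,
    smul_eq_mul, currentForm, waveForm, innerSL_apply_apply] at key ⊢
  field_simp
  linear_combination -key

/-- The current momentum per unit mass obeys the Euler equation, without wave terms. -/
theorem IsSolution.currentForm_transport (hS : IsSolution σ Fr ρref a b 𝒟₀ 𝒟 φ S) (hFr : Fr ≠ 0)
    (h𝒟₀ : IsOpen 𝒟₀) (h𝒟 : IsOpen 𝒟) {t : ℝ} (ht : t ∈ Ioo a b) {r : Plane} (hr : r ∈ 𝒟) :
    fderiv ℝ (uncurry S.currentForm) (t, r) (1, S.v t r)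
      + (S.currentForm t r).comp (fderiv ℝ (S.v t) r)
    = -((S.ρ t r)⁻¹ • fderiv ℝ (S.p t) r - fderiv ℝ (fun r' => ‖S.v t r'‖ ^ 2 / 2) r) := by
  have hs := hS.smooth
  have hnhds := spaceTime_mem_nhds h𝒟 (mk_mem_spaceTime ht hr)
  have hcd := (hs.currentForm.differentiableOn (by simp)).differentiableAt hnhds
  have hwd := ((hs.waveForm (σ := σ) h𝒟).differentiableOn (by simp)).differentiableAt hnhds
  have htot := hS.totalForm_transport h𝒟₀ h𝒟 ht hr
  have hwave := hS.waveForm_transport hFr h𝒟₀ h𝒟 ht hr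
  have hsum : HasFDerivAt (uncurry fun t r => S.currentForm t r + S.waveForm σ t r)
      (fderiv ℝ (uncurry S.currentForm) (t, r) + fderiv ℝ (uncurry (S.waveForm σ)) (t, r))
      (t, r) := hcd.hasFDerivAt.add hwd.hasFDerivAt
  have hζ := contDiffAt_slice h𝒟 hs.ζ ht hr
  have hv := contDiffAt_slice h𝒟 hs.v ht hr
  have hw := contDiffAt_slice h𝒟 (hs.w h𝒟) ht hr
  have hpot : DifferentiableAt ℝ (fun r' => ρref * S.ζ t r' ^ 2 / (2 * Fr ^ 2)) r :=
    ((contDiffAt_const.mul (hζ.pow 2)).div_const _).differentiableAt (by simp)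
  have hp : DifferentiableAt ℝ (S.p t) r :=
    (contDiffAt_slice h𝒟 hs.p ht hr).differentiableAt (by simp)
  have hkw : DifferentiableAt ℝ (fun r' => σ ^ 2 * S.w t r' ^ 2 / 2) r :=
    ((contDiffAt_const.mul (hw.pow 2)).div_const _).differentiableAt (by simp)
  have hkv : DifferentiableAt ℝ (fun r' => ‖S.v t r'‖ ^ 2 / 2) r :=
    ((hv.norm_sq ℝ).div_const _).differentiableAt (by simp)
  have hP : HasFDerivAt (S.totalPressure Fr ρref t) (fderiv ℝ (S.p t) r
      + fderiv ℝ (fun r' => ρref * S.ζ t r' ^ 2 / (2 * Fr ^ 2)) r) r :=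
    hp.hasFDerivAt.add hpot.hasFDerivAt
  have hK : HasFDerivAt (S.totalKinetic σ t) (fderiv ℝ (fun r' => ‖S.v t r'‖ ^ 2 / 2) r
      + fderiv ℝ (fun r' => σ ^ 2 * S.w t r' ^ 2 / 2) r) r := by
    refine (hkv.hasFDerivAt.add hkw.hasFDerivAt).congr_of_eventuallyEq
      (Eventually.of_forall fun r' => ?_)
    exact add_div _ _ _
  rw [hsum.fderiv, hP.fderiv, hK.fderiv] at htot
  ext u
  have h1 := congrArg (fun A : Plane →L[ℝ] ℝ => A u) htot
  have h2 := congrArg (fun A : Plane →L[ℝ] ℝ => A u) hwave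
  simp only [add_apply, sub_apply, smul_apply, neg_apply, ContinuousLinearMap.comp_apply,
    smul_eq_mul] at h1 h2 ⊢
  linear_combination h1 - h2

/-- The circulation of a transported momentum form round a material loop. -/
theorem IsSolution.hasDerivAt_circulation (hS : IsSolution σ Fr ρref a b 𝒟₀ 𝒟 φ S)
    (h𝒟₀ : IsOpen 𝒟₀) (h𝒟 : IsOpen 𝒟) (L : MaterialLoop a b 𝒟₀ φ)
    {α : ℝ → Plane → Plane →L[ℝ] ℝ} (hα : ContDiffOn ℝ ∞ (uncurry α) (spaceTime a b 𝒟)) {t : ℝ}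
    (ht : t ∈ Ioo a b) {β : Plane → Plane →L[ℝ] ℝ}
    (hβ : ∀ r ∈ 𝒟, fderiv ℝ (uncurry α) (t, r) (1, S.v t r)
      + (α t r).comp (fderiv ℝ (S.v t) r) = -β r) :
    HasDerivAt (fun τ => ∫ᶜ r in L.c τ, α τ r) (-∫ᶜ r in L.c t, β r) t := by
  rw [← curveIntegral_fun_neg]
  refine WaveCurrent.hasDerivAt_circulation h𝒟₀ h𝒟 hS.flow (hS.smooth.v.of_le (by simp))
    hS.carried.velocity L (hα.of_le (by simp)) ht fun r hr u => ?_
  rw [← hβ r hr]; rfl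

theorem gradient_apply (f : Plane → ℝ) (r : Plane) (i : Fin 2) :
    gradient f r i = fderiv ℝ f r (EuclideanSpace.single i 1) := by
  have h : inner ℝ (gradient f r) (EuclideanSpace.single i (1 : ℝ) : Plane)
      = fderiv ℝ f r (EuclideanSpace.single i 1) := by
    rw [gradient, InnerProductSpace.toDual_symm_apply]
  rw [← h, EuclideanSpace.inner_single_right]; simp

/-- Where `∇ρ × ∇p = 0` the one-form `ρ⁻¹ dp - dκ` is closed. -/
theorem baroclinicForm_closed {ρ p κ : Plane → ℝ} {r : Plane} (hρ : ContDiffAt ℝ ∞ ρ r)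
    (hp : ContDiffAt ℝ ∞ p r) (hκ : ContDiffAt ℝ ∞ κ r) (hρ0 : ρ r ≠ 0)
    (hcross : gradCross ρ p r = 0) :
    DifferentiableAt ℝ (fun r => (ρ r)⁻¹ • fderiv ℝ p r - fderiv ℝ κ r) r ∧
    ∀ u v, fderiv ℝ (fun r => (ρ r)⁻¹ • fderiv ℝ p r - fderiv ℝ κ r) r u v
      = fderiv ℝ (fun r => (ρ r)⁻¹ • fderiv ℝ p r - fderiv ℝ κ r) r v u := by
  have hdp := ((hp.fderiv_right (m := 1) (by norm_cast)).differentiableAt (by simp)).hasFDerivAt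
  have hdκ := ((hκ.fderiv_right (m := 1) (by norm_cast)).differentiableAt (by simp)).hasFDerivAt
  have hρd := (hρ.differentiableAt (by simp)).hasFDerivAt
  have hinv := (hasDerivAt_inv hρ0).comp_hasFDerivAt r hρd
  have hform := (hinv.smul hdp).sub hdκ
  have hform' : HasFDerivAt (fun r => (ρ r)⁻¹ • fderiv ℝ p r - fderiv ℝ κ r) _ r := hform
  refine ⟨hform'.differentiableAt, fun u v => ?_⟩
  have hp2 := (hp.isSymmSndFDerivAt (by simp; norm_cast)).eq u v
  have hκ2 := (hκ.isSymmSndFDerivAt (by simp; norm_cast)).eq u v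
  -- In the plane `dρ ∧ dp` is `∇ρ × ∇p` times the area form, so it vanishes on every pair `u`, `v`.
  -- It is the only antisymmetric part of the derivative, both Hessians being symmetric.
  have hpar : fderiv ℝ ρ r u * fderiv ℝ p r v = fderiv ℝ ρ r v * fderiv ℝ p r u := by
    rw [gradCross, gradient_apply, gradient_apply, gradient_apply, gradient_apply] at hcross
    rw [eq_single_add_single u, eq_single_add_single v]
    simp only [map_add, map_smul, smul_eq_mul]
    linear_combination (u 0 * v 1 - u 1 * v 0) * hcross
  rw [hform'.fderiv]
  simp only [Function.comp_apply, sub_apply, add_apply, smul_apply,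
    ContinuousLinearMap.smulRight_apply, smul_eq_mul, hp2, hκ2]
  linear_combination -(ρ r ^ 2)⁻¹ * hpar

end Circulation

end WaveCurrent

open WaveCurrent
theorem mainTheorem2 (σ Fr ρref : ℝ) (hσ : 0 < σ) (hFr : 0 < Fr) (hρref : 0 < ρref)
    (a b : ℝ) (𝒟₀ 𝒟 : Set Plane) (h𝒟₀ : IsOpen 𝒟₀) (h𝒟 : IsOpen 𝒟)
    (φ : ℝ → Plane → Plane) (S : Fields) (hS : IsSolution σ Fr ρref a b 𝒟₀ 𝒟 φ S)
    (L : MaterialLoop a b 𝒟₀ φ) (t : ℝ) (ht : t ∈ Ioo a b) :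
    -- the circulation of the current and the wave together
    HasDerivAt (fun τ => ∫ᶜ r in L.c τ, (S.currentForm τ r + S.waveForm σ τ r))
      (- ∫ᶜ r in L.c t, ((S.ρ t r)⁻¹ • fderiv ℝ (S.totalPressure Fr ρref t) r
        - fderiv ℝ (S.totalKinetic σ t) r)) t ∧
    -- the wave part: it accounts for all the wave terms above
    HasDerivAt (fun τ => ∫ᶜ r in L.c τ, S.waveForm σ τ r)
      (- ∫ᶜ r in L.c t, ((S.ρ t r)⁻¹ • fderiv ℝ (fun r' => ρref * S.ζ t r' ^ 2 / (2 * Fr ^ 2)) r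
        - fderiv ℝ (fun r' => σ ^ 2 * S.w t r' ^ 2 / 2) r)) t ∧
    -- the circulation of the current alone
    HasDerivAt (fun τ => ∫ᶜ r in L.c τ, S.currentForm τ r)
      (- ∫ᶜ r in L.c t, ((S.ρ t r)⁻¹ • fderiv ℝ (S.p t) r
        - fderiv ℝ (fun r' => ‖S.v t r'‖ ^ 2 / 2) r)) t ∧
    -- generation of circulation of the current requires nonzero `∇ρ × ∇p`
    (∀ U : Set Plane, IsOpen U → U ⊆ 𝒟 → ContractibleIn U (L.c t) →
      (∀ r ∈ U, gradCross (S.ρ t) (S.p t) r = 0) →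
      HasDerivAt (fun τ => ∫ᶜ r in L.c τ, S.currentForm τ r) 0 t) := by
  have hs := hS.smooth
  have hcurrent := hS.hasDerivAt_circulation h𝒟₀ h𝒟 L hs.currentForm ht
    fun r hr => hS.currentForm_transport hFr.ne' h𝒟₀ h𝒟 ht hr
  refine ⟨hS.hasDerivAt_circulation h𝒟₀ h𝒟 L
      (α := fun τ r => S.currentForm τ r + S.waveForm σ τ r)
      (hs.currentForm.add (hs.waveForm h𝒟)) ht
      fun r hr => hS.totalForm_transport h𝒟₀ h𝒟 ht hr,
    hS.hasDerivAt_circulation h𝒟₀ h𝒟 L (hs.waveForm h𝒟) ht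
      fun r hr => hS.waveForm_transport hFr.ne' h𝒟₀ h𝒟 ht hr,
    hcurrent, fun U hU hU𝒟 hcontr hcross => ?_⟩
  obtain ⟨H, hH⟩ := hcontr
  have hclosed := fun r (hr : r ∈ U) => baroclinicForm_closed
    (contDiffAt_slice h𝒟 hs.ρ ht (hU𝒟 hr)) (contDiffAt_slice h𝒟 hs.p ht (hU𝒟 hr))
    (((contDiffAt_slice h𝒟 hs.v ht (hU𝒟 hr)).norm_sq ℝ).div_const 2)
    (hS.buoyancy_pos t ht r (hU𝒟 hr)).ne' (hcross r hr)
  -- The rate of change is an integral over `L.c t` alone, so closedness and contractibility matter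
  -- only at this instant.
  rw [curveIntegral_eq_zero_of_homotopy_refl hU
    (fun r hr => (hclosed r hr).1.differentiableWithinAt) (fun r hr => (hclosed r hr).2)
    (L.contDiffOn_extend hS.flow h𝒟₀ ht) H hH, neg_zero] at hcurrent
  exact hcurrent
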